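/- Let $\mathcal H,\mathcal K$ be complex Hilbert spaces and let $\mathbf L(\mathcal H,\mathcal K)$ be the space of bounded operators $\mathcal H\to\mathcal K$. Let $H^\infty_{\mathbf L(\mathcal H,\mathcal K)}(\mathbb D)$ be the set of bounded holomorphic $\mathbf L(\mathcal H,\mathcal K)$-valued functions on the unit disk $\mathbb D$, and let $H^2_{\mathcal H}(\mathbb D)$ be the Hardy space of functions $f(z)=\sum_{n\ge0} z^n f_n$ with $f_n\in\mathcal H$ and $\|f\|^2=\sum_n\|f_n\|^2<\infty$. A function $F\in H^\infty_{\mathbf L(\mathcal H,\mathcal K)}(\mathbb D)$ is called outer if there is a closed subspace $\mathcal M\subseteq\mathcal K$ such that the closure of $\{Ff: f\in H^2_{\mathcal H}(\mathbb D)\}$ is $H^2_{\mathcal M}(\mathbb D)$. For bounded holomorphic operator-valued functions $F,G$ on $\mathbb D$ with domain $\mathcal H$, "$G^*G=F^*F$ a.e. on $\mathbb T$" means that for all $x,y\in\mathcal H$ the radial boundary values satisfy $\langle Gx,Gy\rangle=\langle Fx,Fy\rangle$ almost everywhere on the unit circle $\mathbb T$ (for separable $\mathcal H$ the null set can be chosen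 independently of $x,y$). Operators are compared in the order in which $A\le B$ means that $B-A$ is positive semidefinite. For a function $F$ with Taylor coefficients $F_0,F_1,\dots$ at $0$, and $k\ge 0$, put $$T_k(F)=\begin{pmatrix}F_0&&\\ \vdots&\ddots&\\ F_k&\cdots&F_0\end{pmatrix}.$$ Let $F\in H^\infty_{\mathbf L(\mathcal H,\mathcal K)}(\mathbb D)$, and let $\mathcal C_F$ be the set of all $G\in H^\infty_{\mathbf L(\mathcal H,\mathcal K)}(\mathbb D)$ with $G^*G=F^*F$ a.e. on $\mathbb T$; write $F_j$, $G_j$ for the Taylor coefficients of $F$, $G$. The following are equivalent: 1. $F$ is outer; 2. for every $z\in\mathbb D$ and every $G\in\mathcal C_F$, $G(z)^*G(z)\le F(z)^*F(z)$; 3. there is $z_0\in\mathbb D$ such that $G(z_0)^*G(z_0)\le F(z_0)^*F(z_0)$ for every $G\in\mathcal C_F$; 4. $G_0^*G_0\le F_0^*F_0$ for every $G\in\mathcal C_F$; 5. there is $k\ge0$ such that $\sum_{i=0}^{l}G_i^*G_i\le\sum_{i=0}^{l}F_i^*F_i$ for $l=0,\dots,k$ and every $G\in\mathcal C_F$; 6.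 for every $k\ge0$ and every $G\in\mathcal C_F$, $\sum_{i=0}^{k}G_i^*G_i\le\sum_{i=0}^{k}F_i^*F_i$; 7. there is $k\ge0$ such that $T_k(G)^*T_k(G)\le T_k(F)^*T_k(F)$ for every $G\in\mathcal C_F$; 8. for every $k\ge0$ and every $G\in\mathcal C_F$, $T_k(G)^*T_k(G)\le T_k(F)^*T_k(F)$. Moreover, if $F$ is outer, then the inequalities in 2, 4, 6 and 8 hold for every $G\in H^\infty_{\mathbf L(\mathcal H,\mathcal L)}(\mathbb D)$ with $G^*G=F^*F$ a.e. on $\mathbb T$, where $\mathcal L$ is any complex Hilbert space. -/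

import Mathlib

open Filter Topology MeasureTheory

open scoped ContinuousLinearMap

noncomputable section

/-- The bounded holomorphic functions on the open unit disk with values in the Banach space
`E →L[ℂ] E'` of bounded operators. Only the values on the disk matter. -/
structure IsHInfty {E E' : Type*} [NormedAddCommGroup E] [InnerProductSpace ℂ E]
    [NormedAddCommGroup E'] [InnerProductSpace ℂ E'] (F : ℂ → E →L[ℂ] E') : Prop where
  holomorphic : DifferentiableOn ℂ F (Metric.ball 0 1)
  bounded : ∃ C : ℝ, ∀ z ∈ Metric.ball (0 : ℂ) 1, ‖F z‖ ≤ C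

/-- The `j`-th Taylor coefficient at the origin of an operator-valued function. -/
def taylorCoeff {E E' : Type*} [NormedAddCommGroup E] [InnerProductSpace ℂ E]
    [NormedAddCommGroup E'] [InnerProductSpace ℂ E'] (F : ℂ → E →L[ℂ] E') (j : ℕ) : E →L[ℂ] E' :=
  ((j.factorial : ℂ)⁻¹) • iteratedDeriv j F 0

/-- The Hardy space of `E`-valued functions on the unit disk, a function `∑ zⁿ fₙ` being
identified with its square summable sequence of Taylor coefficients. -/
abbrev HardyTwo (E : Type*) [NormedAddCommGroup E] [InnerProductSpace ℂ E] : Type _ :=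
  lp (fun _ : ℕ => E) 2

/-- The value at a point `z` of the disk of an element of the Hardy space. -/
def HardyTwo.eval {E : Type*} [NormedAddCommGroup E] [InnerProductSpace ℂ E]
    (f : HardyTwo E) (z : ℂ) : E :=
  ∑' n : ℕ, z ^ n • f n

/-- The range of the multiplication operator `f ↦ F f` between Hardy spaces. -/
def multRange {E E' : Type*} [NormedAddCommGroup E] [InnerProductSpace ℂ E]
    [NormedAddCommGroup E'] [InnerProductSpace ℂ E'] (F : ℂ → E →L[ℂ] E') : Set (HardyTwo E') :=
  {g | ∃ f : HardyTwo E, ∀ z ∈ Metric.ball (0 : ℂ) 1, g.eval z = F z (f.eval z)}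

/-- The Hardy space of functions with values in a subspace `M`, inside that of `E`. -/
def hardySub {E : Type*} [NormedAddCommGroup E] [InnerProductSpace ℂ E] (M : Submodule ℂ E) :
    Set (HardyTwo E) :=
  {g | ∀ n : ℕ, g n ∈ M}

/-- `F` is outer: multiplication by `F` has dense range in the Hardy space of some (closed)
subspace `M` of the target space. -/
def IsOuter {E E' : Type*} [NormedAddCommGroup E] [InnerProductSpace ℂ E]
    [NormedAddCommGroup E'] [InnerProductSpace ℂ E'] (F : ℂ → E →L[ℂ] E') : Prop :=
  ∃ M : Submodule ℂ E', IsClosed (M : Set E') ∧ closure (multRange F) = hardySub M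

/-- `f` has the radial boundary value `a` at the point `exp (i t)` of the unit circle. -/
def HasRadialLimit {E : Type*} [NormedAddCommGroup E] (f : ℂ → E) (t : ℝ) (a : E) : Prop :=
  Tendsto (fun r : ℝ => f (circleMap 0 r t)) (𝓝[<] 1) (𝓝 a)

/-- `G* G = F* F` almost everywhere on the unit circle, as an identity between (weakly measurable)
operator-valued functions: for all vectors `x`, `y`, the radial boundary values satisfy
`⟪G x, G y⟫ = ⟪F x, F y⟫` almost everywhere. For a separable domain the exceptional null set
can be chosen independently of `x` and `y`; for a nonseparable one the strong boundary values of
`F` need not exist simultaneously for all vectors at any point of the circle. -/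
def SameModulus {E E₁ E₂ : Type*} [NormedAddCommGroup E] [InnerProductSpace ℂ E]
    [NormedAddCommGroup E₁] [InnerProductSpace ℂ E₁] [NormedAddCommGroup E₂]
    [InnerProductSpace ℂ E₂] (G : ℂ → E →L[ℂ] E₂) (F : ℂ → E →L[ℂ] E₁) : Prop :=
  ∀ x y : E, ∀ᵐ t : ℝ, ∃ a b : E₁, ∃ c d : E₂,
    HasRadialLimit (fun z => F z x) t a ∧ HasRadialLimit (fun z => F z y) t b ∧
    HasRadialLimit (fun z => G z x) t c ∧ HasRadialLimit (fun z => G z y) t d ∧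
    inner ℂ c d = inner ℂ a b

/-- `G` is a bounded holomorphic function with `G* G = F* F` almost everywhere on the circle. -/
def IsCompetitor {E E₁ E₂ : Type*} [NormedAddCommGroup E] [InnerProductSpace ℂ E]
    [NormedAddCommGroup E₁] [InnerProductSpace ℂ E₁] [NormedAddCommGroup E₂]
    [InnerProductSpace ℂ E₂] (F : ℂ → E →L[ℂ] E₁) (G : ℂ → E →L[ℂ] E₂) : Prop :=
  IsHInfty G ∧ SameModulus G F

/-- `A* A`. -/
def gram {E E' : Type*} [NormedAddCommGroup E] [InnerProductSpace ℂ E] [CompleteSpace E]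
    [NormedAddCommGroup E'] [InnerProductSpace ℂ E'] [CompleteSpace E'] (A : E →L[ℂ] E') :
    E →L[ℂ] E :=
  (ContinuousLinearMap.adjoint A) ∘L A

/-- The block lower triangular Toeplitz operator `E^(k+1) → E'^(k+1)` (orthogonal sums) whose
entry in row `i` and column `j` is the Taylor coefficient of `F` of index `i - j` if `j ≤ i`,
and `0` otherwise. -/
def toeplitzBlock {E E' : Type*} [NormedAddCommGroup E] [InnerProductSpace ℂ E]
    [NormedAddCommGroup E'] [InnerProductSpace ℂ E'] (F : ℂ → E →L[ℂ] E') (k : ℕ) :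
    PiLp 2 (fun _ : Fin (k + 1) => E) →L[ℂ] PiLp 2 (fun _ : Fin (k + 1) => E') :=
  ((PiLp.continuousLinearEquiv 2 ℂ (fun _ : Fin (k + 1) => E')).symm :
      (∀ _ : Fin (k + 1), E') →L[ℂ] PiLp 2 (fun _ : Fin (k + 1) => E')) ∘L
    ContinuousLinearMap.pi fun i : Fin (k + 1) =>
      ∑ j : Fin (k + 1), if j ≤ i then
        taylorCoeff F ((i : ℕ) - (j : ℕ)) ∘L
          (PiLp.proj 2 (fun _ : Fin (k + 1) => E) j : PiLp 2 (fun _ : Fin (k + 1) => E) →L[ℂ] E)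
      else 0

end

noncomputable section

/-! A bounded holomorphic `F` is identified with the multiplication operator `hF.mult` on Hardy
spaces, which commutes with the shift. By Fatou's theorem, and because the Fourier coefficients of
the Gram form of the boundary values are inner products of images of monomials, `G* G = F* F` on the
circle holds exactly when the two multiplication operators have the same Gram form
(`IsHInfty.inner_mult_eq`, `IsHInfty.sameModulus_of_inner_mult_eq`).

Let `F` be outer and `G` a competitor. Then `F f ↦ G f` is isometric on the range of `F`; extend it
to the closure and by zero to the orthogonal complement. The closure is the Hardy space of a
subspace, so both it and its complement are shift invariant, and the resulting contraction `V`
commutes with the shift (`exists_commutesShift_contraction`). Such a contraction decreases norms of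
point values (`norm_evalCLM_map_le`) and partial sums of squared coefficient norms
(`sum_norm_sq_map_le`). All the inequalities follow, for any target space of `G`.

Conversely, assume domination at one point `z₀`. The closure `N` of the range of `F` is shift
invariant. With `W = N ⊖ zN`, the Wold decomposition gives an isometry `Θ` from the Hardy space of
`W` onto `N` (`ShiftInvariant.range_wold`), so multiplication by `F` is `Θ C` with `C` of dense
range. A counting argument with orthonormal bases gives an isometry `J : W → K`
(`ShiftInvariant.exists_isometry`), and `J C` represents a competitor with values in `K`. Domination
at `z₀` now says `‖u(z₀)‖ ≤ ‖(Θ u)(z₀)‖`, first for `u` in the range of `C`, then for all `u`. For a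
constant `u = w` the function `Θ u` is `w` itself, which therefore attains its maximal norm at `z₀`
and is constant by the maximum principle. So `W` consists of constants, `N` is the Hardy space of a
subspace, and `F` is outer. -/

/-- The Hardy space `HardyTwo E` as a type whose algebraic and topological structure is derived
from its norm and inner product only. -/
def HardySpace (E : Type*) [NormedAddCommGroup E] [InnerProductSpace ℂ E] : Type _ :=
  lp (fun _ : ℕ => E) 2

namespace HardySpace

variable {E : Type*} [NormedAddCommGroup E] [InnerProductSpace ℂ E]

instance : NormedAddCommGroup (HardySpace E) :=
  inferInstanceAs (NormedAddCommGroup (lp (fun _ : ℕ => E) 2))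

instance : InnerProductSpace ℂ (HardySpace E) :=
  inferInstanceAs (InnerProductSpace ℂ (lp (fun _ : ℕ => E) 2))

instance [CompleteSpace E] : CompleteSpace (HardySpace E) :=
  inferInstanceAs (CompleteSpace (lp (fun _ : ℕ => E) 2))

/-- The sequence of coefficients. -/
def coeff (f : HardySpace E) (n : ℕ) : E := f.1 n

instance : CoeFun (HardySpace E) fun _ => ℕ → E := ⟨coeff⟩

/-! ### Coefficients, shift and point evaluations on the Hardy space -/

omit [InnerProductSpace ℂ E] in
theorem memℓp_two_iff {f : ℕ → E} : Memℓp f 2 ↔ Summable fun n => ‖f n‖ ^ 2 := by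
  rw [memℓp_gen_iff (by norm_num)]
  norm_num

/-- The element of the Hardy space with given square summable coefficients. -/
def mk (f : ℕ → E) (hf : Summable fun n => ‖f n‖ ^ 2) : HardySpace E := ⟨f, memℓp_two_iff.2 hf⟩

@[simp] theorem mk_coeff (f : ℕ → E) (hf : Summable fun n => ‖f n‖ ^ 2) (n : ℕ) :
    mk f hf n = f n := rfl

@[ext] theorem ext {f g : HardySpace E} (h : ∀ n, f n = g n) : f = g :=
  lp.ext (funext h)

@[simp] theorem add_coeff (f g : HardySpace E) (n : ℕ) : (f + g) n = f n + g n := rfl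

@[simp] theorem sub_coeff (f g : HardySpace E) (n : ℕ) : (f - g) n = f n - g n := rfl

@[simp] theorem zero_coeff (n : ℕ) : (0 : HardySpace E) n = 0 := rfl

@[simp] theorem smul_coeff (c : ℂ) (f : HardySpace E) (n : ℕ) : (c • f) n = c • f n := rfl

theorem summable_norm_sq (f : HardySpace E) : Summable fun n => ‖f n‖ ^ 2 :=
  memℓp_two_iff.1 (lp.memℓp f)

theorem norm_sq_eq_tsum (f : HardySpace E) : ‖f‖ ^ 2 = ∑' n, ‖f n‖ ^ 2 := by
  have := lp.norm_rpow_eq_tsum (E := fun _ : ℕ => E) (p := 2) (by norm_num) f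
  norm_num at this
  exact this

theorem norm_coeff_le (f : HardySpace E) (n : ℕ) : ‖f n‖ ≤ ‖f‖ :=
  lp.norm_apply_le_norm (E := fun _ : ℕ => E) (p := 2) (by norm_num) f n

theorem hasSum_inner (f g : HardySpace E) : HasSum (fun n => inner ℂ (f n) (g n)) (inner ℂ f g) :=
  lp.hasSum_inner (𝕜 := ℂ) (G := fun _ : ℕ => E) f g

/-- The `n`-th coefficient as a bounded operator. -/
def coeffCLM (E : Type*) [NormedAddCommGroup E] [InnerProductSpace ℂ E] (n : ℕ) :
    HardySpace E →L[ℂ] E :=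
  LinearMap.mkContinuous ⟨⟨fun f => f n, fun _ _ => rfl⟩, fun _ _ => rfl⟩ 1 fun f =>
    (norm_coeff_le f n).trans_eq (one_mul _).symm

@[simp] theorem coeffCLM_apply (n : ℕ) (f : HardySpace E) : coeffCLM E n f = f n := rfl

theorem norm_coeffCLM_le (n : ℕ) : ‖coeffCLM E n‖ ≤ 1 :=
  LinearMap.mkContinuous_norm_le _ zero_le_one _

/-- The monomial `zⁿ x`, depending linearly on `x`. -/
def monomial (E : Type*) [NormedAddCommGroup E] [InnerProductSpace ℂ E] (n : ℕ) :
    E →ₗᵢ[ℂ] HardySpace E where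
  toFun x := (lp.single 2 n x : lp (fun _ : ℕ => E) 2)
  map_add' := lp.single_add (E := fun _ : ℕ => E) 2 n
  map_smul' c x := lp.single_smul (E := fun _ : ℕ => E) 2 n c x
  norm_map' := lp.norm_single (E := fun _ => E) (p := 2) (by norm_num) n

theorem monomial_coeff (n m : ℕ) (x : E) : (monomial E n x) m = if m = n then x else 0 := by
  have := congrFun (lp.coeFn_single (E := fun _ : ℕ => E) 2 n x) m
  rw [Pi.single_apply] at this
  exact this

@[simp] theorem monomial_coeff_self (n : ℕ) (x : E) : (monomial E n x) n = x := by
  simp [monomial_coeff]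

theorem inner_monomial_left (n : ℕ) (x : E) (f : HardySpace E) :
    inner ℂ (monomial E n x) f = inner ℂ x (f n) :=
  lp.inner_single_left (𝕜 := ℂ) (G := fun _ => E) n x f

theorem hasSum_monomial (f : HardySpace E) : HasSum (fun n => monomial E n (f n)) f :=
  lp.hasSum_single (E := fun _ : ℕ => E) (p := 2) (by norm_num) f

theorem clm_ext {F : Type*} [NormedAddCommGroup F] [NormedSpace ℂ F]
    {S T : HardySpace E →L[ℂ] F} (h : ∀ n x, S (monomial E n x) = T (monomial E n x)) :
    S = T := by
  ext f
  refine (S.hasSum (hasSum_monomial f)).unique ?_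
  simpa only [h] using T.hasSum (hasSum_monomial f)

/-- The coefficient sequence of `z f`. -/
def shiftSeq (f : ℕ → E) : ℕ → E
  | 0 => 0
  | n + 1 => f n

/-- Multiplication by the variable. -/
def shift (E : Type*) [NormedAddCommGroup E] [InnerProductSpace ℂ E] :
    HardySpace E →ₗᵢ[ℂ] HardySpace E where
  toFun f := mk (shiftSeq f) ((summable_nat_add_iff 1).1 (summable_norm_sq f))
  map_add' f g := by
    ext n
    cases n with
    | zero => exact (add_zero (0 : E)).symm
    | succ n => rfl
  map_smul' c f := by
    ext n
    cases n with
    | zero => exact (smul_zero c).symm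
    | succ n => rfl
  norm_map' f := by
    refine (sq_eq_sq₀ (norm_nonneg _) (norm_nonneg _)).1 ?_
    rw [norm_sq_eq_tsum, norm_sq_eq_tsum, Summable.tsum_eq_zero_add (summable_norm_sq _)]
    simp [shiftSeq]

@[simp] theorem shift_coeff_zero (f : HardySpace E) : shift E f 0 = 0 := rfl

@[simp] theorem shift_coeff_succ (f : HardySpace E) (n : ℕ) : shift E f (n + 1) = f n := rfl

@[simp] theorem shift_monomial (n : ℕ) (x : E) :
    shift E (monomial E n x) = monomial E (n + 1) x := by
  ext m
  cases m <;> simp [monomial_coeff]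

theorem shift_iterate_coeff (k : ℕ) (f : HardySpace E) (n : ℕ) :
    ((shift E)^[k] f) n = if k ≤ n then f (n - k) else 0 := by
  induction k generalizing n with
  | zero => simp
  | succ k ih =>
    rw [Function.iterate_succ_apply']
    cases n with
    | zero => simp
    | succ n => simp [ih]

theorem norm_shift_iterate (k : ℕ) (f : HardySpace E) : ‖(shift E)^[k] f‖ = ‖f‖ := by
  induction k with
  | zero => rfl
  | succ k ih => rw [Function.iterate_succ_apply', LinearIsometry.norm_map, ih]

theorem inner_shift_iterate (k : ℕ) (f g : HardySpace E) :
    inner ℂ ((shift E)^[k] f) ((shift E)^[k] g) = inner ℂ f g := by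
  induction k with
  | zero => rfl
  | succ k ih => rw [Function.iterate_succ_apply', Function.iterate_succ_apply',
      LinearIsometry.inner_map_map, ih]

theorem shift_iterate_monomial (k : ℕ) (x : E) :
    (shift E)^[k] (monomial E 0 x) = monomial E k x := by
  induction k with
  | zero => rfl
  | succ k ih => rw [Function.iterate_succ_apply', ih, shift_monomial]

section Complete

variable [CompleteSpace E]

theorem adjoint_shift_coeff (f : HardySpace E) (n : ℕ) :
    ((shift E).toContinuousLinearMap.adjoint f) n = f (n + 1) := by
  refine ext_inner_left ℂ fun x => ?_
  rw [← inner_monomial_left, ContinuousLinearMap.adjoint_inner_right,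
    LinearIsometry.coe_toContinuousLinearMap, shift_monomial, inner_monomial_left]

/-- Evaluation at a point, as a bounded operator. Only points of the disk matter. -/
def evalCLM (E : Type*) [NormedAddCommGroup E] [InnerProductSpace ℂ E] (z : ℂ) :
    HardySpace E →L[ℂ] E :=
  ∑' n : ℕ, z ^ n • coeffCLM E n

theorem summable_evalCLM {z : ℂ} (hz : ‖z‖ < 1) : Summable fun n : ℕ => z ^ n • coeffCLM E n := by
  refine Summable.of_norm_bounded (summable_geometric_of_lt_one (norm_nonneg z) hz) fun n => ?_
  rw [norm_smul, norm_pow]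
  exact mul_le_of_le_one_right (by positivity) (norm_coeffCLM_le n)

theorem hasSum_evalCLM {z : ℂ} (hz : ‖z‖ < 1) (f : HardySpace E) :
    HasSum (fun n : ℕ => z ^ n • f n) (evalCLM E z f) := by
  have h := ContinuousLinearMap.hasSum (ContinuousLinearMap.apply ℂ E f)
    (summable_evalCLM (E := E) hz).hasSum
  exact h

theorem evalCLM_apply {z : ℂ} (hz : ‖z‖ < 1) (f : HardySpace E) : 
    evalCLM E z f = HardyTwo.eval (E := E) f z :=
  (hasSum_evalCLM hz f).tsum_eq.symm

theorem differentiableOn_evalCLM : DifferentiableOn ℂ (evalCLM E) (Metric.ball 0 1) := by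
  intro z hz
  rw [mem_ball_zero_iff] at hz
  -- The geometric majorant is uniform only on disks of radius `r < 1`, so holomorphy is proved on
  -- such a disk around `z`.
  obtain ⟨r, hzr, hr⟩ := exists_between hz
  have hr0 : 0 ≤ r := (norm_nonneg z).trans hzr.le
  have : DifferentiableOn ℂ (fun w : ℂ => ∑' n : ℕ, w ^ n • coeffCLM E n)
      (Metric.ball 0 r) := by
    refine Complex.differentiableOn_tsum_of_summable_norm
      (summable_geometric_of_lt_one hr0 hr) (fun n => ?_) Metric.isOpen_ball fun n w hw => ?_
    · exact ((differentiable_id.pow n).smul_const _).differentiableOn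
    · rw [norm_smul, norm_pow]
      rw [mem_ball_zero_iff] at hw
      exact (mul_le_of_le_one_right (by positivity) (norm_coeffCLM_le n)).trans
        (pow_le_pow_left₀ (norm_nonneg w) hw.le n)
  exact ((this z (by simpa using hzr)).differentiableAt
    (Metric.isOpen_ball.mem_nhds (by simpa using hzr))).differentiableWithinAt

theorem evalCLM_monomial {z : ℂ} (hz : ‖z‖ < 1) (n : ℕ) (x : E) :
    evalCLM E z (monomial E n x) = z ^ n • x := by
  refine (hasSum_evalCLM hz _).unique ?_
  convert hasSum_ite_eq n (z ^ n • x) using 2 with m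
  rw [monomial_coeff]
  split_ifs with h
  · rw [h]
  · simp

theorem evalCLM_shift {z : ℂ} (hz : ‖z‖ < 1) (f : HardySpace E) :
    evalCLM E z (shift E f) = z • evalCLM E z f := by
  refine (hasSum_evalCLM hz _).unique ?_
  rw [← hasSum_nat_add_iff' 1]
  simpa [pow_succ', mul_smul] using (hasSum_evalCLM hz f).const_smul z

end Complete

end HardySpace

/-! ### Parseval's identity on circles -/

section Parseval

variable {E : Type*} [NormedAddCommGroup E] [InnerProductSpace ℂ E] [CompleteSpace E]

theorem norm_circleMap_one (t : ℝ) : ‖circleMap 0 1 t‖ = 1 := by simp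

theorem integral_circleMap_pow (m n : ℕ) :
    ∫ t in (0 : ℝ)..2 * Real.pi, (starRingEnd ℂ) (circleMap 0 1 t ^ m) * circleMap 0 1 t ^ n =
      if m = n then (2 * Real.pi : ℂ) else 0 := by
  have key : ∀ t : ℝ, (starRingEnd ℂ) (circleMap 0 1 t ^ m) * circleMap 0 1 t ^ n =
      Complex.exp (((n : ℂ) - m) * Complex.I * t) := by
    intro t
    simp only [circleMap, zero_add, Complex.ofReal_one, one_mul, map_natCast, ← Complex.exp_conj,
      map_mul, Complex.conj_ofReal, Complex.conj_I, ← Complex.exp_nat_mul, ← Complex.exp_add]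
    congr 1
    ring
  simp_rw [key]
  split_ifs with h
  · subst h; simp
  · have hnm : ((n : ℂ) - m) ≠ 0 := sub_ne_zero.2 (by exact_mod_cast Ne.symm h)
    rw [integral_exp_mul_complex (mul_ne_zero hnm Complex.I_ne_zero)]
    have : Complex.exp (((n : ℂ) - m) * Complex.I * (2 * Real.pi : ℝ)) = 1 := by
      rw [Complex.exp_eq_one_iff]
      exact ⟨(n : ℤ) - m, by push_cast; ring⟩
    rw [this]
    simp

/-- Termwise integration of an absolutely convergent series of continuous functions. -/
theorem hasSum_intervalIntegral_of_norm_le {F : Type*} [NormedAddCommGroup F] [NormedSpace ℝ F] [CompleteSpace F]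
    {f : ℕ → ℝ → F} {u : ℕ → ℝ} {a b : ℝ} (hf : ∀ n, Continuous (f n)) (hu : Summable u)
    (hfu : ∀ n t, ‖f n t‖ ≤ u n) :
    HasSum (fun n => ∫ t in a..b, f n t) (∫ t in a..b, ∑' n, f n t) := by
  refine intervalIntegral.hasSum_integral_of_dominated_convergence (fun n _ => u n)
    (fun n => (hf n).aestronglyMeasurable) (fun n => ae_of_all _ fun t _ => hfu n t)
    (ae_of_all _ fun t _ => hu) (by simp) (ae_of_all _ fun t _ => ?_)
  exact (Summable.of_norm_bounded hu fun n => hfu n t).hasSum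

theorem continuous_tsum_circleMap_pow_smul {a : ℕ → E} (ha : Summable fun n => ‖a n‖) :
    Continuous fun t : ℝ => ∑' n, circleMap 0 1 t ^ n • a n :=
  continuous_tsum (fun n => by fun_prop) ha fun n t => by
    rw [norm_smul, norm_pow, norm_circleMap_one]; simp

theorem summable_circleMap_pow_smul {a : ℕ → E} (ha : Summable fun n => ‖a n‖) (t : ℝ) :
    Summable fun n => circleMap 0 1 t ^ n • a n :=
  Summable.of_norm_bounded ha fun n => by
    rw [norm_smul, norm_pow, norm_circleMap_one]; simp

theorem integral_conj_circleMap_pow_smul_tsum {a : ℕ → E} (ha : Summable fun n => ‖a n‖) (m : ℕ) :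
    ∫ t in (0 : ℝ)..2 * Real.pi,
        (starRingEnd ℂ) (circleMap 0 1 t ^ m) • ∑' n, circleMap 0 1 t ^ n • a n =
      (2 * Real.pi : ℂ) • a m := by
  have h1 := hasSum_intervalIntegral_of_norm_le (a := 0) (b := 2 * Real.pi)
    (f := fun n t => ((starRingEnd ℂ) (circleMap 0 1 t ^ m) * circleMap 0 1 t ^ n) • a n)
    (fun n => by
      refine Continuous.smul (Continuous.mul (Complex.continuous_conj.comp ?_) ?_)
        continuous_const <;> fun_prop) ha
    (fun n t => by simp [norm_smul])
  simp_rw [intervalIntegral.integral_smul_const, integral_circleMap_pow, mul_smul] at h1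
  rw [show (fun t : ℝ => (starRingEnd ℂ) (circleMap 0 1 t ^ m) • ∑' n, circleMap 0 1 t ^ n • a n) =
    fun t : ℝ => ∑' n, (starRingEnd ℂ) (circleMap 0 1 t ^ m) • circleMap 0 1 t ^ n • a n from
    funext fun t => ((summable_circleMap_pow_smul ha t).tsum_const_smul _).symm]
  refine h1.unique ?_
  convert hasSum_ite_eq m ((2 * Real.pi : ℂ) • a m) using 2 with n
  split_ifs with h h' h'
  · rw [h']
  · exact absurd h.symm h'
  · exact absurd h'.symm h
  · simp

/-- Only the second series is expanded under the integral. The `m`-th term then pairs `b m` with the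
`m`-th Fourier coefficient of the first series, which is `a m`. -/
theorem hasSum_inner_of_summable_norm {a b : ℕ → E} (ha : Summable fun n => ‖a n‖)
    (hb : Summable fun n => ‖b n‖) :
    HasSum (fun n => (2 * Real.pi : ℂ) * inner ℂ (a n) (b n))
      (∫ t in (0 : ℝ)..2 * Real.pi,
        inner ℂ (∑' n, circleMap 0 1 t ^ n • a n) (∑' n, circleMap 0 1 t ^ n • b n)) := by
  have hA := continuous_tsum_circleMap_pow_smul ha
  have hnA : ∀ t : ℝ, ‖∑' n, circleMap 0 1 t ^ n • a n‖ ≤ ∑' n, ‖a n‖ := fun t => by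
    refine (norm_tsum_le_tsum_norm ?_).trans_eq ?_ <;> simp [norm_smul, ha]
  have h1 := hasSum_intervalIntegral_of_norm_le (a := 0) (b := 2 * Real.pi)
    (f := fun n t => inner ℂ (∑' n, circleMap 0 1 t ^ n • a n) (circleMap 0 1 t ^ n • b n))
    (fun n => by fun_prop) (hb.mul_left (∑' n, ‖a n‖))
    (fun n t => by
      refine (norm_inner_le_norm _ _).trans ?_
      rw [norm_smul, norm_pow, norm_circleMap_one, one_pow, one_mul]
      gcongr
      exact hnA t)
  have h2 : ∀ t : ℝ, ∑' m, inner ℂ (∑' n, circleMap 0 1 t ^ n • a n) (circleMap 0 1 t ^ m • b m) =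
      inner ℂ (∑' n, circleMap 0 1 t ^ n • a n) (∑' n, circleMap 0 1 t ^ n • b n) := fun t =>
    ((summable_circleMap_pow_smul hb t).hasSum.mapL (innerSL ℂ _)).tsum_eq
  simp_rw [h2] at h1
  refine HasSum.congr_fun h1 fun m => ?_
  have h3 : ∀ t : ℝ, inner ℂ (∑' n, circleMap 0 1 t ^ n • a n) (circleMap 0 1 t ^ m • b m) =
      (starRingEnd ℂ) (inner ℂ (b m)
        ((starRingEnd ℂ) (circleMap 0 1 t ^ m) • ∑' n, circleMap 0 1 t ^ n • a n)) := fun t => by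
    rw [inner_conj_symm, inner_smul_right, inner_smul_left, Complex.conj_conj]
  simp_rw [h3]
  rw [intervalIntegral.integral_of_le Real.two_pi_pos.le, integral_conj, integral_inner,
    ← intervalIntegral.integral_of_le Real.two_pi_pos.le,
    integral_conj_circleMap_pow_smul_tsum ha, inner_conj_symm, inner_smul_left]
  · simp [map_ofNat]
  · refine (Continuous.integrableOn_Icc ?_).mono_set Set.Ioc_subset_Icc_self
    exact (Complex.continuous_conj.comp (by fun_prop)).smul hA

theorem hasSum_norm_sq_of_summable_norm {a : ℕ → E} (ha : Summable fun n => ‖a n‖) :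
    HasSum (fun n => 2 * Real.pi * ‖a n‖ ^ 2)
      (∫ t in (0 : ℝ)..2 * Real.pi, ‖∑' n, circleMap 0 1 t ^ n • a n‖ ^ 2) := by
  have h := hasSum_inner_of_summable_norm ha ha
  simp_rw [inner_self_eq_norm_sq_to_K] at h
  rw [← Complex.hasSum_ofReal]
  convert h using 1
  · ext n; push_cast; rfl
  · rw [← intervalIntegral.integral_ofReal]
    push_cast; rfl

end Parseval

/-! ### Means over circles inside the disk -/

namespace HardySpace

variable {E : Type*} [NormedAddCommGroup E] [InnerProductSpace ℂ E] [CompleteSpace E]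

omit [CompleteSpace E] in
theorem summable_norm_pow_smul {r : ℝ} (hr0 : 0 ≤ r) (hr : r < 1) (f : HardySpace E) :
    Summable fun n => ‖(r : ℂ) ^ n • f n‖ := by
  refine Summable.of_nonneg_of_le (fun n => norm_nonneg _) (fun n => ?_)
    ((summable_geometric_of_lt_one hr0 hr).mul_right ‖f‖)
  rw [norm_smul, norm_pow, Complex.norm_real, Real.norm_of_nonneg hr0]
  gcongr
  exact norm_coeff_le f n

theorem norm_circleMap_lt_one {r : ℝ} (hr0 : 0 ≤ r) (hr : r < 1) (t : ℝ) :
    ‖circleMap 0 r t‖ < 1 := by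
  simpa [abs_of_nonneg hr0] using hr

theorem circleMap_eq_mul (r t : ℝ) : circleMap 0 r t = r * circleMap 0 1 t := by
  simp [circleMap]

theorem tsum_circleMap_pow_smul_eq_evalCLM {r : ℝ} (hr0 : 0 ≤ r) (hr : r < 1) (f : HardySpace E)
    (t : ℝ) : ∑' n, circleMap 0 1 t ^ n • (r : ℂ) ^ n • f n = evalCLM E (circleMap 0 r t) f := by
  rw [← (hasSum_evalCLM (norm_circleMap_lt_one hr0 hr t) f).tsum_eq]
  refine tsum_congr fun n => ?_
  rw [circleMap_eq_mul r t, smul_smul, mul_pow, mul_comm]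

/-- The means of `⟪f, g⟫` over circles increase to the inner product in the Hardy space. -/
theorem hasSum_inner_evalCLM {r : ℝ} (hr0 : 0 ≤ r) (hr : r < 1) (f g : HardySpace E) :
    HasSum (fun n => (2 * Real.pi : ℂ) * ((r : ℂ) ^ (2 * n) * inner ℂ (f n) (g n)))
      (∫ t in (0 : ℝ)..2 * Real.pi,
        inner ℂ (evalCLM E (circleMap 0 r t) f) (evalCLM E (circleMap 0 r t) g)) := by
  have h := hasSum_inner_of_summable_norm (summable_norm_pow_smul hr0 hr f)
    (summable_norm_pow_smul hr0 hr g)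
  simp_rw [tsum_circleMap_pow_smul_eq_evalCLM hr0 hr] at h
  convert h using 2 with n
  rw [inner_smul_left, inner_smul_right, map_pow, Complex.conj_ofReal]
  ring

/-- Parseval on the circle of radius `1 / 2`, applied to `f - g`, forces every coefficient of the
difference to vanish. -/
theorem evalCLM_injective {f g : HardySpace E} (h : ∀ z : ℂ, ‖z‖ < 1 → evalCLM E z f = evalCLM E z g) :
    f = g := by
  rw [← sub_eq_zero]
  have h1 := hasSum_norm_sq_of_summable_norm
    (summable_norm_pow_smul (r := 1 / 2) (by norm_num) (by norm_num) (f - g))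
  simp_rw [tsum_circleMap_pow_smul_eq_evalCLM (r := 1 / 2) (by norm_num) (by norm_num),
    map_sub, h _ (norm_circleMap_lt_one (r := 1 / 2) (by norm_num) (by norm_num) _)] at h1
  simp only [sub_self, norm_zero, ne_eq, OfNat.ofNat_ne_zero, not_false_eq_true, zero_pow,
    intervalIntegral.integral_zero] at h1
  rw [hasSum_zero_iff_of_nonneg fun n => by positivity] at h1
  ext n
  have := congrFun h1 n
  simpa [Real.pi_ne_zero] using this

theorem tendsto_integral_inner_evalCLM (f g : HardySpace E) :
    Tendsto (fun r : ℝ => ∫ t in (0 : ℝ)..2 * Real.pi,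
        inner ℂ (evalCLM E (circleMap 0 r t) f) (evalCLM E (circleMap 0 r t) g))
      (𝓝[<] 1) (𝓝 (2 * Real.pi * inner ℂ f g)) := by
  have hev : ∀ᶠ r : ℝ in 𝓝[<] 1, 0 ≤ r ∧ r < 1 := by
    filter_upwards [Ioo_mem_nhdsLT (zero_lt_one' ℝ)] with r hr using ⟨hr.1.le, hr.2⟩
  have h1 : Tendsto (fun r : ℝ => ∑' n, (2 * Real.pi : ℂ) * ((r : ℂ) ^ (2 * n) * inner ℂ (f n) (g n)))
      (𝓝[<] 1) (𝓝 (∑' n, (2 * Real.pi : ℂ) * inner ℂ (f n) (g n))) := by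
    refine tendsto_tsum_of_dominated_convergence
      (bound := fun n => 2 * Real.pi * ‖(inner ℂ (f n) (g n) : ℂ)‖)
      ((hasSum_inner f g).summable.norm.mul_left _) (fun n => ?_) ?_
    · have : Continuous fun r : ℝ =>
          (2 * Real.pi : ℂ) * ((r : ℂ) ^ (2 * n) * inner ℂ (f n) (g n)) := by fun_prop
      simpa using (this.tendsto 1).mono_left nhdsWithin_le_nhds
    · filter_upwards [hev] with r hr n
      rw [norm_mul, norm_mul (_ ^ _), norm_pow, Complex.norm_real, Real.norm_of_nonneg hr.1,
        show ‖(2 * Real.pi : ℂ)‖ = 2 * Real.pi by simp [Real.pi_pos.le]]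
      gcongr
      exact mul_le_of_le_one_left (norm_nonneg _) (pow_le_one₀ hr.1 hr.2.le)
  rw [tsum_mul_left, (hasSum_inner f g).tsum_eq] at h1
  refine h1.congr' ?_
  filter_upwards [hev] with r hr
  exact (hasSum_inner_evalCLM hr.1 hr.2 f g).tsum_eq

end HardySpace

namespace HardySpace

variable {E : Type*} [NormedAddCommGroup E] [InnerProductSpace ℂ E] [CompleteSpace E]
  {E' : Type*} [NormedAddCommGroup E'] [InnerProductSpace ℂ E'] [CompleteSpace E']

/-! ### Operators commuting with the shift -/

/-- `T` intertwines the shifts. -/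
def CommutesShift {E E' : Type*} [NormedAddCommGroup E] [InnerProductSpace ℂ E]
    [NormedAddCommGroup E'] [InnerProductSpace ℂ E'] (T : HardySpace E →L[ℂ] HardySpace E') :
    Prop :=
  ∀ f, T (shift E f) = shift E' (T f)

omit [CompleteSpace E] [CompleteSpace E'] in
theorem CommutesShift.iterate {T : HardySpace E →L[ℂ] HardySpace E'} (hT : CommutesShift T) (k : ℕ)
    (f : HardySpace E) : T ((shift E)^[k] f) = (shift E')^[k] (T f) := by
  induction k with
  | zero => rfl
  | succ k ih => rw [Function.iterate_succ_apply', hT, ih, Function.iterate_succ_apply']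

theorem adjoint_evalCLM_coeff {z : ℂ} (hz : ‖z‖ < 1) (y : E) (n : ℕ) :
    ((evalCLM E z).adjoint y) n = (starRingEnd ℂ) z ^ n • y := by
  refine ext_inner_left ℂ fun x => ?_
  rw [← inner_monomial_left, ContinuousLinearMap.adjoint_inner_right, evalCLM_monomial hz,
    inner_smul_left, inner_smul_right, map_pow]

/-- Reproducing kernels are the only eigenvectors of the backward shift: the eigenvalue equation is
a recursion that determines all coefficients from the constant one. -/
theorem eq_adjoint_evalCLM {z : ℂ} (hz : ‖z‖ < 1) {h : HardySpace E}
    (hh : (shift E).toContinuousLinearMap.adjoint h = (starRingEnd ℂ) z • h) :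
    h = (evalCLM E z).adjoint (h 0) := by
  ext n
  rw [adjoint_evalCLM_coeff hz]
  induction n with
  | zero => simp
  | succ n ih => rw [← adjoint_shift_coeff, hh, smul_coeff, ih, smul_smul, pow_succ']

theorem norm_adjoint_evalCLM_sq {z : ℂ} (hz : ‖z‖ < 1) (y : E) :
    ‖(evalCLM E z).adjoint y‖ ^ 2 = (∑' n : ℕ, (‖z‖ ^ n) ^ 2) * ‖y‖ ^ 2 := by
  rw [norm_sq_eq_tsum, ← tsum_mul_right]
  refine tsum_congr fun n => ?_
  rw [adjoint_evalCLM_coeff hz, norm_smul, norm_pow, RCLike.norm_conj, mul_pow]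

/-- The adjoint of `T` commutes with the backward shifts, so it maps a kernel vector at `z` to an
eigenvector, hence to another kernel vector at `z`. Both kernels have norm equal to the same factor
(depending on `‖z‖` only) times the norm of their coefficient vector; cancelling it bounds the new
coefficient vector by `‖T‖ * ‖y‖`. Duality gives the claim, which later yields the symbol, its
boundedness and the pointwise operator inequality. -/
theorem norm_evalCLM_map_le {T : HardySpace E →L[ℂ] HardySpace E'} (hT : CommutesShift T) {z : ℂ}
    (hz : ‖z‖ < 1) (g : HardySpace E) : ‖evalCLM E' z (T g)‖ ≤ ‖T‖ * ‖evalCLM E z g‖ := by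
  set y := evalCLM E' z (T g) with hy
  set h := T.adjoint ((evalCLM E' z).adjoint y) with hh
  have hcoinv : (shift E).toContinuousLinearMap.adjoint h = (starRingEnd ℂ) z • h := by
    refine ext_inner_left ℂ fun f => ?_
    rw [hh, ContinuousLinearMap.adjoint_inner_right, ContinuousLinearMap.adjoint_inner_right,
      ContinuousLinearMap.adjoint_inner_right, inner_smul_right,
      ContinuousLinearMap.adjoint_inner_right, ContinuousLinearMap.adjoint_inner_right,
      LinearIsometry.coe_toContinuousLinearMap, hT, evalCLM_shift hz, inner_smul_left]
  have hm := eq_adjoint_evalCLM hz hcoinv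
  have hc : 0 < ∑' n : ℕ, (‖z‖ ^ n) ^ 2 := by
    have hs : Summable fun n : ℕ => (‖z‖ ^ n) ^ 2 := by
      simp_rw [← pow_mul, mul_comm _ 2, pow_mul]
      exact summable_geometric_of_lt_one (by positivity) (by nlinarith [norm_nonneg z])
    exact hs.tsum_pos (fun n => by positivity) 0 (by simp)
  have hmy : ‖h 0‖ ≤ ‖T‖ * ‖y‖ := by
    have h1 : ‖h‖ ≤ ‖T‖ * ‖(evalCLM E' z).adjoint y‖ := by
      refine (ContinuousLinearMap.le_opNorm _ _).trans_eq ?_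
      rw [LinearIsometryEquiv.norm_map]
    have h2 : ‖h‖ ^ 2 ≤ (‖T‖ * ‖(evalCLM E' z).adjoint y‖) ^ 2 := by gcongr
    rw [hm, mul_pow, norm_adjoint_evalCLM_sq hz, norm_adjoint_evalCLM_sq hz, mul_left_comm] at h2
    refine (sq_le_sq₀ (norm_nonneg _) (by positivity)).1 ?_
    rw [mul_pow]
    exact le_of_mul_le_mul_left h2 hc
  have hle : ‖y‖ * ‖y‖ ≤ ‖y‖ * (‖T‖ * ‖evalCLM E z g‖) := by
    have h1 : inner ℂ y y = inner ℂ (h 0) (evalCLM E z g) := by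
      conv_lhs => rw [hy, ← ContinuousLinearMap.adjoint_inner_left,
        ← ContinuousLinearMap.adjoint_inner_left, ← hy, ← hh, hm,
        ContinuousLinearMap.adjoint_inner_left]
    calc ‖y‖ * ‖y‖ = ‖(inner ℂ y y : ℂ)‖ := by
            rw [inner_self_eq_norm_sq_to_K, norm_pow]
            simp [sq]
      _ ≤ ‖h 0‖ * ‖evalCLM E z g‖ := by rw [h1]; exact norm_inner_le_norm _ _
      _ ≤ ‖T‖ * ‖y‖ * ‖evalCLM E z g‖ := by gcongr
      _ = _ := by ring
  rcases (norm_nonneg y).eq_or_lt with h0 | h0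
  · rw [← h0]; positivity
  · exact le_of_mul_le_mul_left hle h0

/-- The operator-valued function that represents an operator commuting with the shifts. -/
def symbol (T : HardySpace E →L[ℂ] HardySpace E') (z : ℂ) : E →L[ℂ] E' :=
  evalCLM E' z ∘L T ∘L (monomial E 0).toContinuousLinearMap

omit [CompleteSpace E] [CompleteSpace E'] in
theorem symbol_apply (T : HardySpace E →L[ℂ] HardySpace E') (z : ℂ) (x : E) :
    symbol T z x = evalCLM E' z (T (monomial E 0 x)) := rfl

/-- The value of `T g` at `z` depends only on the value of `g` at `z`: the preceding bound is
applied to `g` minus the constant function with that value. -/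
theorem evalCLM_map {T : HardySpace E →L[ℂ] HardySpace E'} (hT : CommutesShift T) {z : ℂ}
    (hz : ‖z‖ < 1) (g : HardySpace E) : evalCLM E' z (T g) = symbol T z (evalCLM E z g) := by
  have h := norm_evalCLM_map_le hT hz (g - monomial E 0 (evalCLM E z g))
  rw [map_sub (evalCLM E z), evalCLM_monomial hz, pow_zero, one_smul, sub_self, norm_zero,
    mul_zero, norm_le_zero_iff, map_sub, map_sub, sub_eq_zero] at h
  exact h

theorem isHInfty_symbol {T : HardySpace E →L[ℂ] HardySpace E'} (hT : CommutesShift T) :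
    IsHInfty (symbol T) where
  holomorphic := differentiableOn_evalCLM.clm_comp (differentiableOn_const _)
  bounded := by
    refine ⟨‖T‖, fun z hz => ContinuousLinearMap.opNorm_le_bound _ (norm_nonneg _) fun x => ?_⟩
    rw [mem_ball_zero_iff] at hz
    refine (norm_evalCLM_map_le hT hz _).trans_eq ?_
    change ‖T‖ * ‖evalCLM E z (monomial E 0 x)‖ = _
    rw [evalCLM_monomial hz, pow_zero, one_smul]

end HardySpace

/-! ### Power series in the disk -/

section PowerSeries

theorem continuous_comp_circleMap {E : Type*} [NormedAddCommGroup E] [NormedSpace ℂ E] {u : ℂ → E}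
    {r : ℝ} (hu : DifferentiableOn ℂ u (Metric.ball 0 1)) (hr0 : 0 ≤ r) (hr : r < 1) :
    Continuous fun t => u (circleMap 0 r t) :=
  hu.continuousOn.comp_continuous (continuous_circleMap 0 _) fun t =>
    mem_ball_zero_iff.2 (HardySpace.norm_circleMap_lt_one hr0 hr t)

theorem hasSum_pow_smul_taylor {E : Type*} [NormedAddCommGroup E] [NormedSpace ℂ E]
    [CompleteSpace E] {u : ℂ → E} (hu : DifferentiableOn ℂ u (Metric.ball 0 1)) {z : ℂ}
    (hz : ‖z‖ < 1) :
    HasSum (fun n : ℕ => z ^ n • (n.factorial : ℂ)⁻¹ • iteratedDeriv n u 0) (u z) := by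
  have := Complex.hasSum_taylorSeries_on_ball hu (mem_ball_zero_iff.2 hz)
  simpa only [sub_zero, smul_comm (z ^ _)] using this

variable {E : Type*} [NormedAddCommGroup E] [InnerProductSpace ℂ E] [CompleteSpace E]

-- Convergence at an intermediate radius `s` bounds the terms there, and the ratio `r / s < 1`
-- supplies a geometric majorant.
omit [CompleteSpace E] in
theorem summable_norm_pow_smul_of_summable {a : ℕ → E}
    (ha : ∀ z : ℂ, ‖z‖ < 1 → Summable fun n => z ^ n • a n) {r : ℝ} (hr0 : 0 ≤ r) (hr : r < 1) :
    Summable fun n => ‖(r : ℂ) ^ n • a n‖ := by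
  obtain ⟨s, hrs, hs⟩ := exists_between hr
  have hs0 : 0 < s := hr0.trans_lt hrs
  have hbdd := (ha s (by rwa [Complex.norm_real, Real.norm_of_nonneg hs0.le])).tendsto_atTop_zero
  obtain ⟨M, hM⟩ := (hbdd.norm.bddAbove_range)
  have hle : ∀ n, ‖(r : ℂ) ^ n • a n‖ ≤ (r / s) ^ n * M := fun n => by
    have h1 : ‖(s : ℂ) ^ n • a n‖ ≤ M := hM ⟨n, rfl⟩
    rw [norm_smul, norm_pow, Complex.norm_real, Real.norm_of_nonneg hs0.le] at h1
    rw [norm_smul, norm_pow, Complex.norm_real, Real.norm_of_nonneg hr0, div_pow]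
    calc r ^ n * ‖a n‖ = r ^ n / s ^ n * (s ^ n * ‖a n‖) := by field_simp
      _ ≤ _ := by gcongr
  exact Summable.of_nonneg_of_le (fun n => norm_nonneg _) hle
    ((summable_geometric_of_lt_one (by positivity) ((div_lt_one hs0).2 hrs)).mul_right M)

theorem integral_norm_sq_circleMap {a : ℕ → E} {g : ℂ → E}
    (ha : ∀ z : ℂ, ‖z‖ < 1 → HasSum (fun n => z ^ n • a n) (g z)) {r : ℝ} (hr0 : 0 ≤ r)
    (hr : r < 1) :
    HasSum (fun n => 2 * Real.pi * (r ^ (2 * n) * ‖a n‖ ^ 2))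
      (∫ t in (0 : ℝ)..2 * Real.pi, ‖g (circleMap 0 r t)‖ ^ 2) := by
  have h1 := hasSum_norm_sq_of_summable_norm
    (summable_norm_pow_smul_of_summable (fun z hz => (ha z hz).summable) hr0 hr)
  convert h1 using 1
  · ext n
    rw [norm_smul, norm_pow, Complex.norm_real, Real.norm_of_nonneg hr0]
    ring
  · congr 1
    ext t
    rw [← (ha _ (HardySpace.norm_circleMap_lt_one hr0 hr t)).tsum_eq]
    congr 3
    ext n
    rw [HardySpace.circleMap_eq_mul r t, smul_smul, mul_pow, mul_comm]

theorem powerSeries_coeff_unique {a b : ℕ → E} {g : ℂ → E}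
    (ha : ∀ z : ℂ, ‖z‖ < 1 → HasSum (fun n => z ^ n • a n) (g z))
    (hb : ∀ z : ℂ, ‖z‖ < 1 → HasSum (fun n => z ^ n • b n) (g z)) (n : ℕ) : a n = b n := by
  have h : ∀ z : ℂ, ‖z‖ < 1 → HasSum (fun n => z ^ n • (a n - b n)) ((fun _ => 0 : ℂ → E) z) :=
    fun z hz => by simpa [smul_sub] using (ha z hz).sub (hb z hz)
  have h1 := integral_norm_sq_circleMap h (r := 1 / 2) (by norm_num) (by norm_num)
  simp only [norm_zero, ne_eq, OfNat.ofNat_ne_zero, not_false_eq_true, zero_pow,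
    intervalIntegral.integral_zero] at h1
  rw [hasSum_zero_iff_of_nonneg fun n => by positivity] at h1
  have := congrFun h1 n
  simpa [Real.pi_ne_zero, sub_eq_zero] using this

/-- A function with a power series whose circular square means are bounded is in the Hardy space. -/
theorem summable_norm_sq_of_integral_le {a : ℕ → E} {g : ℂ → E} {M : ℝ}
    (ha : ∀ z : ℂ, ‖z‖ < 1 → HasSum (fun n => z ^ n • a n) (g z))
    (hM : ∀ r : ℝ, 0 ≤ r → r < 1 →
      ∫ t in (0 : ℝ)..2 * Real.pi, ‖g (circleMap 0 r t)‖ ^ 2 ≤ 2 * Real.pi * M) :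
    Summable (fun n => ‖a n‖ ^ 2) ∧ ∑' n, ‖a n‖ ^ 2 ≤ M := by
  have hfin : ∀ s : Finset ℕ, ∑ n ∈ s, ‖a n‖ ^ 2 ≤ M := fun s => by
    -- A finite partial sum is continuous in the radius, so its bound passes to `r → 1`; the bound
    -- does not depend on the finite set.
    have hlim : Tendsto (fun r : ℝ => ∑ n ∈ s, r ^ (2 * n) * ‖a n‖ ^ 2) (𝓝[<] 1)
        (𝓝 (∑ n ∈ s, ‖a n‖ ^ 2)) := by
      have : Continuous fun r : ℝ => ∑ n ∈ s, r ^ (2 * n) * ‖a n‖ ^ 2 := by fun_prop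
      simpa using (this.tendsto 1).mono_left nhdsWithin_le_nhds
    refine le_of_tendsto hlim ?_
    filter_upwards [Ioo_mem_nhdsLT (zero_lt_one' ℝ)] with r hr
    have h1 := integral_norm_sq_circleMap ha hr.1.le hr.2
    have h2 : ∑ n ∈ s, 2 * Real.pi * (r ^ (2 * n) * ‖a n‖ ^ 2) ≤ _ :=
      sum_le_hasSum s (fun n _ => mul_nonneg Real.two_pi_pos.le
        (mul_nonneg (pow_nonneg hr.1.le _) (sq_nonneg _))) h1
    rw [← Finset.mul_sum] at h2
    exact le_of_mul_le_mul_left (h2.trans (hM r hr.1.le hr.2)) Real.two_pi_pos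
  have hs := summable_of_sum_le (fun n => sq_nonneg ‖a n‖) hfin
  exact ⟨hs, hs.tsum_le_of_sum_le hfin⟩

end PowerSeries

/-! ### Multiplication operators -/

namespace IsHInfty

open HardySpace

variable {E : Type*} [NormedAddCommGroup E] [InnerProductSpace ℂ E] [CompleteSpace E]
  {E' : Type*} [NormedAddCommGroup E'] [InnerProductSpace ℂ E'] [CompleteSpace E']
  {F : ℂ → E →L[ℂ] E'}

/-- The product `z ↦ F z (f z)` is holomorphic, and its square means over circles are at most `C ^
2` times those of `f`, so its Taylor coefficients are square summable. -/
theorem exists_mult (hF : IsHInfty F) {C : ℝ} (hC : ∀ z ∈ Metric.ball (0 : ℂ) 1, ‖F z‖ ≤ C)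
    (f : HardySpace E) :
    ∃ g : HardySpace E', ‖g‖ ≤ C * ‖f‖ ∧
      ∀ z : ℂ, ‖z‖ < 1 → evalCLM E' z g = F z (evalCLM E z f) := by
  have hC0 : 0 ≤ C := (norm_nonneg _).trans (hC 0 (by simp))
  have hdf : DifferentiableOn ℂ (fun z => evalCLM E z f) (Metric.ball 0 1) :=
    differentiableOn_evalCLM.clm_apply (differentiableOn_const f)
  have hd : DifferentiableOn ℂ (fun z => F z (evalCLM E z f)) (Metric.ball 0 1) :=
    hF.holomorphic.clm_apply hdf
  set g : ℂ → E' := fun z => F z (evalCLM E z f) with hg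
  set a : ℕ → E' := fun n => (n.factorial : ℂ)⁻¹ • iteratedDeriv n g 0 with ha
  have hsum : ∀ z : ℂ, ‖z‖ < 1 → HasSum (fun n => z ^ n • a n) (g z) := fun z hz => by
    exact hasSum_pow_smul_taylor hd hz
  have hM : ∀ r : ℝ, 0 ≤ r → r < 1 →
      ∫ t in (0 : ℝ)..2 * Real.pi, ‖g (circleMap 0 r t)‖ ^ 2 ≤
        2 * Real.pi * (C ^ 2 * ‖f‖ ^ 2) := fun r hr0 hr => by
    have h1 := integral_norm_sq_circleMap (fun z hz => hasSum_evalCLM hz f) hr0 hr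
    have h2 : ∫ t in (0 : ℝ)..2 * Real.pi, ‖evalCLM E (circleMap 0 r t) f‖ ^ 2 ≤
        2 * Real.pi * ‖f‖ ^ 2 := by
      rw [norm_sq_eq_tsum]
      refine hasSum_le (fun n => ?_) h1 ((summable_norm_sq f).hasSum.mul_left _)
      have := pow_le_one₀ (n := 2 * n) hr0 hr.le
      have := Real.pi_pos
      gcongr
      exact mul_le_of_le_one_left (sq_nonneg _) ‹_›
    calc ∫ t in (0 : ℝ)..2 * Real.pi, ‖g (circleMap 0 r t)‖ ^ 2
        ≤ ∫ t in (0 : ℝ)..2 * Real.pi, C ^ 2 * ‖evalCLM E (circleMap 0 r t) f‖ ^ 2 := by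
          refine intervalIntegral.integral_mono_on Real.two_pi_pos.le
            (((continuous_comp_circleMap hd hr0 hr).norm.pow 2).intervalIntegrable _ _)
            ((((continuous_comp_circleMap hdf hr0 hr).norm.pow 2).const_mul _).intervalIntegrable _ _) fun t _ => ?_
          rw [← mul_pow]
          gcongr
          refine (ContinuousLinearMap.le_opNorm _ _).trans ?_
          gcongr
          exact hC _ (mem_ball_zero_iff.2 (norm_circleMap_lt_one hr0 hr t))
      _ ≤ _ := by
          rw [intervalIntegral.integral_const_mul]
          nlinarith [sq_nonneg C]
  obtain ⟨hs, hle⟩ := summable_norm_sq_of_integral_le hsum hM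
  refine ⟨HardySpace.mk a hs, ?_, fun z hz => ?_⟩
  · refine (sq_le_sq₀ (norm_nonneg _) (by positivity)).1 ?_
    rw [norm_sq_eq_tsum, mul_pow]
    exact hle
  · exact (hasSum_evalCLM hz _).unique (hsum z hz)

/-- Multiplication by a bounded holomorphic function as a bounded operator. -/
def mult (hF : IsHInfty F) : HardySpace E →L[ℂ] HardySpace E' :=
  LinearMap.mkContinuous
    { toFun := fun f => (hF.exists_mult hF.bounded.choose_spec f).choose
      map_add' := fun f g => evalCLM_injective fun z hz => by
        rw [(hF.exists_mult hF.bounded.choose_spec _).choose_spec.2 z hz, map_add, map_add,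
          map_add, (hF.exists_mult hF.bounded.choose_spec _).choose_spec.2 z hz,
          (hF.exists_mult hF.bounded.choose_spec _).choose_spec.2 z hz]
      map_smul' := fun c f => evalCLM_injective fun z hz => by
        rw [(hF.exists_mult hF.bounded.choose_spec _).choose_spec.2 z hz, RingHom.id_apply,
          map_smul, map_smul, map_smul,
          (hF.exists_mult hF.bounded.choose_spec _).choose_spec.2 z hz] }
    hF.bounded.choose fun f => (hF.exists_mult hF.bounded.choose_spec f).choose_spec.1

theorem evalCLM_mult (hF : IsHInfty F) {z : ℂ} (hz : ‖z‖ < 1) (f : HardySpace E) :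
    evalCLM E' z (hF.mult f) = F z (evalCLM E z f) :=
  (hF.exists_mult hF.bounded.choose_spec f).choose_spec.2 z hz

theorem commutesShift_mult (hF : IsHInfty F) : CommutesShift hF.mult := fun f =>
  evalCLM_injective fun z hz => by
    rw [evalCLM_mult hF hz, evalCLM_shift hz, evalCLM_shift hz, evalCLM_mult hF hz, map_smul]

theorem symbol_mult (hF : IsHInfty F) {z : ℂ} (hz : ‖z‖ < 1) : symbol hF.mult z = F z := by
  ext x
  rw [symbol_apply, evalCLM_mult hF hz, evalCLM_monomial hz, pow_zero, one_smul]

theorem mult_symbol {T : HardySpace E →L[ℂ] HardySpace E'} (hT : CommutesShift T) :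
    (isHInfty_symbol hT).mult = T := by
  ext1 f
  exact evalCLM_injective fun z hz => by rw [evalCLM_mult _ hz, evalCLM_map hT hz]

theorem taylorCoeff_apply (hF : IsHInfty F) (n : ℕ) (x : E) :
    taylorCoeff F n x = hF.mult (monomial E 0 x) n := by
  refine powerSeries_coeff_unique (a := fun n => taylorCoeff F n x)
    (g := fun z => F z x) (fun z hz => ?_) (fun z hz => ?_) n
  · have h := ContinuousLinearMap.hasSum (ContinuousLinearMap.apply ℂ E' x)
      (hasSum_pow_smul_taylor hF.holomorphic hz)
    exact h
  · have := hasSum_evalCLM hz (hF.mult (monomial E 0 x))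
    rwa [evalCLM_mult hF hz, evalCLM_monomial hz, pow_zero, one_smul] at this

omit [CompleteSpace E] [CompleteSpace E'] in
theorem taylorCoeff_zero (F : ℂ → E →L[ℂ] E') : taylorCoeff F 0 = F 0 := by
  simp [taylorCoeff]

end IsHInfty

/-! ### The order on operators `A* A` -/

section Gram

variable {E E₁ E₂ : Type*} [NormedAddCommGroup E] [InnerProductSpace ℂ E] [CompleteSpace E]
  [NormedAddCommGroup E₁] [InnerProductSpace ℂ E₁] [CompleteSpace E₁]
  [NormedAddCommGroup E₂] [InnerProductSpace ℂ E₂] [CompleteSpace E₂]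

theorem inner_gram_left (A : E →L[ℂ] E₁) (x y : E) : inner ℂ (gram A x) y = inner ℂ (A x) (A y) := by
  rw [gram, ContinuousLinearMap.comp_apply, ContinuousLinearMap.adjoint_inner_left]

theorem inner_gram_right (A : E →L[ℂ] E₁) (x y : E) :
    inner ℂ x (gram A y) = inner ℂ (A x) (A y) := by
  rw [gram, ContinuousLinearMap.comp_apply, ContinuousLinearMap.adjoint_inner_right]

theorem sum_gram_le_sum_gram_iff {ι : Type*} (s : Finset ι) (A : ι → E →L[ℂ] E₁)
    (B : ι → E →L[ℂ] E₂) :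
    ∑ i ∈ s, gram (A i) ≤ ∑ i ∈ s, gram (B i) ↔
      ∀ x, ∑ i ∈ s, ‖A i x‖ ^ 2 ≤ ∑ i ∈ s, ‖B i x‖ ^ 2 := by
  rw [ContinuousLinearMap.le_def, ContinuousLinearMap.isPositive_def, and_iff_right]
  · refine forall_congr' fun x => ?_
    have : (∑ i ∈ s, gram (B i) - ∑ i ∈ s, gram (A i)).reApplyInnerSelf x =
        ∑ i ∈ s, ‖B i x‖ ^ 2 - ∑ i ∈ s, ‖A i x‖ ^ 2 := by
      simp only [ContinuousLinearMap.reApplyInnerSelf_apply, sub_apply,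
        sum_apply, inner_sub_left, sum_inner, inner_gram_left, map_sub, map_sum,
        inner_self_eq_norm_sq]
    rw [this, sub_nonneg]
  · intro x y
    simp only [ContinuousLinearMap.coe_coe, sub_apply,
      sum_apply, inner_sub_left, inner_sub_right, sum_inner, inner_sum,
      inner_gram_left, inner_gram_right]

theorem gram_le_gram_iff (A : E →L[ℂ] E₁) (B : E →L[ℂ] E₂) :
    gram A ≤ gram B ↔ ∀ x, ‖A x‖ ≤ ‖B x‖ := by
  have := sum_gram_le_sum_gram_iff (Finset.univ : Finset Unit) (fun _ => A) (fun _ => B)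
  simpa [sq_le_sq₀ (norm_nonneg _) (norm_nonneg _)] using this

end Gram

/-! ### Factorisation through a contraction -/

/-- The assignment `A x ↦ B x` is well defined and contractive on the range of `A`; it extends to
the closure and is composed with the orthogonal projection. The vanishing on the complement is
recorded because commutation with the shift has to be checked there separately. -/
theorem exists_contraction_comp_eq {X Y Z : Type*} [NormedAddCommGroup X] [NormedSpace ℂ X]
    [NormedAddCommGroup Y] [InnerProductSpace ℂ Y] [CompleteSpace Y]
    [NormedAddCommGroup Z] [NormedSpace ℂ Z] [CompleteSpace Z] (A : X →L[ℂ] Y) (B : X →L[ℂ] Z)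
    (h : ∀ x, ‖B x‖ ≤ ‖A x‖) :
    ∃ V : Y →L[ℂ] Z, ‖V‖ ≤ 1 ∧ (∀ x, V (A x) = B x) ∧
      ∀ y ∈ (A.range.topologicalClosure)ᗮ, V y = 0 := by
  set N := A.range.topologicalClosure with hN
  have : CompleteSpace N := A.range.isClosed_topologicalClosure.completeSpace_coe
  set e : X →ₗ[ℂ] N := A.toLinearMap.codRestrict N fun x =>
    A.range.le_topologicalClosure ⟨x, rfl⟩ with he
  have hdense : DenseRange e := by
    rintro ⟨y, hy⟩
    rw [closure_subtype]
    refine closure_mono ?_ hy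
    rintro _ ⟨x, rfl⟩
    exact ⟨e x, ⟨x, rfl⟩, rfl⟩
  have hle : ∀ x, ‖(B : X →ₗ[ℂ] Z) x‖ ≤ 1 * ‖e x‖ := fun x => (h x).trans_eq (one_mul _).symm
  set V₀ := (B : X →ₗ[ℂ] Z).extendOfNorm e with hV₀
  refine ⟨V₀ ∘L N.orthogonalProjectionOnto, ?_, fun x => ?_, fun y hy => ?_⟩
  · refine (ContinuousLinearMap.opNorm_comp_le _ _).trans ?_
    refine mul_le_one₀ (LinearMap.opNorm_extendOfNorm_le hdense zero_le_one hle) (norm_nonneg _)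
      N.orthogonalProjectionOnto_norm_le
  · have : N.orthogonalProjectionOnto (A x) = e x :=
      N.orthogonalProjectionOnto_mem_subspace_eq_self (e x)
    rw [ContinuousLinearMap.comp_apply, this]
    exact LinearMap.extendOfNorm_eq hdense ⟨1, hle⟩ x
  · rw [ContinuousLinearMap.comp_apply,
      Submodule.orthogonalProjectionOnto_apply_of_mem_orthogonal hy, map_zero]

/-! ### Contractions commuting with the shift -/

namespace HardySpace

variable {E : Type*} [NormedAddCommGroup E] [InnerProductSpace ℂ E] [CompleteSpace E]
  {K : Type*} [NormedAddCommGroup K] [InnerProductSpace ℂ K] [CompleteSpace K]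
  {L : Type*} [NormedAddCommGroup L] [InnerProductSpace ℂ L] [CompleteSpace L]

omit [CompleteSpace E] in
/-- If the closure of the range of `A` consists of all functions with values in a subspace, and
`‖B f‖ ≤ ‖A f‖`, then `B` factors through `A` by a contraction that commutes with the shift. -/
theorem exists_commutesShift_contraction {A : HardySpace E →L[ℂ] HardySpace K}
    {B : HardySpace E →L[ℂ] HardySpace L} (hA : CommutesShift A) (hB : CommutesShift B)
    (h : ∀ f, ‖B f‖ ≤ ‖A f‖) {M : Submodule ℂ K}
    (hM : closure (Set.range A) = {g : HardySpace K | ∀ n, g n ∈ M}) :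
    ∃ V : HardySpace K →L[ℂ] HardySpace L, ‖V‖ ≤ 1 ∧ CommutesShift V ∧ ∀ f, V (A f) = B f := by
  obtain ⟨V, hV, hVA, hV0⟩ := exists_contraction_comp_eq A B h
  refine ⟨V, hV, fun g => ?_, hVA⟩
  set N := A.range.topologicalClosure with hN
  have hmem : ∀ g : HardySpace K, g ∈ N ↔ ∀ n, g n ∈ M := fun g => by
    have : (N : Set (HardySpace K)) = {g : HardySpace K | ∀ n, g n ∈ M} := by
      rw [← hM, hN, Submodule.topologicalClosure_coe]
      rfl
    exact Set.ext_iff.1 this g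
  have : CompleteSpace N := A.range.isClosed_topologicalClosure.completeSpace_coe
  have h1 : ∀ g ∈ closure (Set.range A), V (shift K g) = shift L (V g) := by
    have hcl : IsClosed {g | V (shift K g) = shift L (V g)} :=
      isClosed_eq (V.continuous.comp (shift K).continuous) ((shift L).continuous.comp V.continuous)
    refine fun g hg => closure_minimal ?_ hcl hg
    rintro _ ⟨f, rfl⟩
    change V (shift K (A f)) = shift L (V (A f))
    rw [← hA, hVA, hVA, hB]
  -- The special form of `N` enters here: membership is tested coefficient by coefficient, so `N` is
  -- invariant under the backward shift and its complement under the shift. This fails for a general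
  -- shift invariant subspace.
  have h2 : ∀ g ∈ Nᗮ, shift K g ∈ Nᗮ := fun g hg => by
    rw [Submodule.mem_orthogonal] at hg ⊢
    intro u hu
    have hu' : (shift K).toContinuousLinearMap.adjoint u ∈ N := by
      rw [hmem] at hu ⊢
      intro n
      rw [adjoint_shift_coeff]
      exact hu _
    have := hg _ hu'
    rwa [ContinuousLinearMap.adjoint_inner_left] at this
  obtain ⟨a, ha, b, hb, rfl⟩ := N.exists_add_mem_mem_orthogonal g
  have ha' : a ∈ closure (Set.range A) := by
    rw [hM]
    exact (hmem a).1 ha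
  rw [map_add, map_add, h1 a ha', hV0 _ (h2 b hb), map_add, hV0 b hb, add_zero, add_zero]

omit [CompleteSpace K] [CompleteSpace L] in
/-- A contraction commuting with the shift decreases the partial sums of the squared norms of the
coefficients. -/
theorem sum_norm_sq_map_le {V : HardySpace K →L[ℂ] HardySpace L} (hV : CommutesShift V)
    (hV1 : ‖V‖ ≤ 1) (g : HardySpace K) (k : ℕ) :
    ∑ i ∈ Finset.range k, ‖V g i‖ ^ 2 ≤ ∑ i ∈ Finset.range k, ‖g i‖ ^ 2 := by
  -- Write `g = u + z ^ k q` with `u` the truncation of `g` below degree `k`. Since `V` commutes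
  -- with the shift, `z ^ k q` does not affect the first `k` coefficients of `V g`.
  set q : HardySpace K := mk (fun n => g (n + k)) ((summable_nat_add_iff k).2 (summable_norm_sq g))
    with hq
  set u := g - (shift K)^[k] q with hu
  have hu1 : ∀ n, u n = if n < k then g n else 0 := fun n => by
    rw [hu, sub_coeff, shift_iterate_coeff]
    rcases lt_or_ge n k with h | h
    · simp [h]
    · simp [h, hq, h.not_gt]
  have hu2 : ‖u‖ ^ 2 = ∑ i ∈ Finset.range k, ‖g i‖ ^ 2 := by
    rw [norm_sq_eq_tsum, tsum_eq_sum (s := Finset.range k)]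
    · refine Finset.sum_congr rfl fun i hi => ?_
      rw [hu1, if_pos (Finset.mem_range.1 hi)]
    · intro i hi
      rw [hu1, if_neg (by simpa using hi)]
      simp
  have hVu : ∀ i < k, V g i = V u i := fun i hi => by
    rw [hu, map_sub, hV.iterate, sub_coeff, shift_iterate_coeff, if_neg hi.not_ge, sub_zero]
  calc ∑ i ∈ Finset.range k, ‖V g i‖ ^ 2 = ∑ i ∈ Finset.range k, ‖V u i‖ ^ 2 :=
        Finset.sum_congr rfl fun i hi => by rw [hVu i (Finset.mem_range.1 hi)]
    _ ≤ ∑' i, ‖V u i‖ ^ 2 := (summable_norm_sq _).sum_le_tsum _ fun i _ => sq_nonneg _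
    _ = ‖V u‖ ^ 2 := (norm_sq_eq_tsum _).symm
    _ ≤ ‖u‖ ^ 2 := by
        gcongr
        exact (V.le_of_opNorm_le hV1 u).trans_eq (one_mul _)
    _ = _ := hu2

end HardySpace

open HardySpace

/-! ### Outer functions, Toeplitz blocks and the resulting inequalities -/

section Outer

variable {E : Type*} [NormedAddCommGroup E] [InnerProductSpace ℂ E] [CompleteSpace E]
  {K : Type*} [NormedAddCommGroup K] [InnerProductSpace ℂ K] [CompleteSpace K]
  {L : Type*} [NormedAddCommGroup L] [InnerProductSpace ℂ L] [CompleteSpace L]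
  {F : ℂ → E →L[ℂ] K} {G : ℂ → E →L[ℂ] L}

theorem IsHInfty.mem_multRange_iff (hF : IsHInfty F) (g : HardySpace K) :
    (show HardyTwo K from g) ∈ multRange F ↔ g ∈ Set.range hF.mult := by
  constructor
  · rintro ⟨f, hf⟩
    refine ⟨(show HardySpace E from f), evalCLM_injective fun z hz => ?_⟩
    rw [hF.evalCLM_mult hz, evalCLM_apply hz, evalCLM_apply hz]
    exact (hf z (mem_ball_zero_iff.2 hz)).symm
  · rintro ⟨f, rfl⟩
    refine ⟨f, fun z hz => ?_⟩
    rw [mem_ball_zero_iff] at hz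
    have := hF.evalCLM_mult hz f
    rwa [evalCLM_apply hz, evalCLM_apply hz] at this

theorem IsHInfty.isOuter_iff (hF : IsHInfty F) :
    IsOuter F ↔ ∃ M : Submodule ℂ K, IsClosed (M : Set K) ∧
      closure (Set.range hF.mult) = {g : HardySpace K | ∀ n, g n ∈ M} := by
  have h : (multRange F : Set (HardyTwo K)) = Set.range hF.mult :=
    Set.ext hF.mem_multRange_iff
  unfold IsOuter
  rw [h]
  rfl

theorem IsHInfty.mult_monomial_coeff (hF : IsHInfty F) (j i : ℕ) (x : E) :
    hF.mult (monomial E j x) i = if j ≤ i then taylorCoeff F (i - j) x else 0 := by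
  rw [← shift_iterate_monomial, hF.commutesShift_mult.iterate, shift_iterate_coeff,
    hF.taylorCoeff_apply]

/-- The block is multiplication by `F` on polynomials of degree at most `k`, followed by truncation;
this reduces the Toeplitz inequality to the one for partial sums. -/
theorem IsHInfty.toeplitzBlock_apply (hF : IsHInfty F) (k : ℕ)
    (u : PiLp 2 fun _ : Fin (k + 1) => E) (i : Fin (k + 1)) :
    toeplitzBlock F k u i = hF.mult (∑ j : Fin (k + 1), monomial E j (u j)) i := by
  have h1 : hF.mult (∑ j : Fin (k + 1), monomial E j (u j)) i =
      ∑ j : Fin (k + 1), hF.mult (monomial E j (u j)) i := by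
    rw [map_sum]
    exact map_sum (coeffCLM K i) _ _
  have h2 : toeplitzBlock F k u i = (∑ j : Fin (k + 1), if j ≤ i then
        taylorCoeff F ((i : ℕ) - (j : ℕ)) ∘L
          (PiLp.proj 2 (fun _ : Fin (k + 1) => E) j : PiLp 2 (fun _ : Fin (k + 1) => E) →L[ℂ] E)
      else 0) u := rfl
  rw [h1, h2, sum_apply]
  refine Finset.sum_congr rfl fun j _ => ?_
  rw [hF.mult_monomial_coeff]
  by_cases h : j ≤ i
  · rw [if_pos h, if_pos (Fin.le_def.1 h)]
    rfl
  · rw [if_neg h, if_neg (fun h' => h (Fin.le_def.2 h'))]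
    rfl

theorem IsHInfty.norm_toeplitzBlock_sq (hF : IsHInfty F) (k : ℕ)
    (u : PiLp 2 fun _ : Fin (k + 1) => E) :
    ‖toeplitzBlock F k u‖ ^ 2 = ∑ i ∈ Finset.range (k + 1),
      ‖hF.mult (∑ j : Fin (k + 1), monomial E j (u j)) i‖ ^ 2 := by
  rw [PiLp.norm_sq_eq_of_L2, Finset.sum_range]
  exact Finset.sum_congr rfl fun i _ => by rw [hF.toeplitzBlock_apply]

/-- The extremal properties that follow from a factorisation of `G` through `F` by a contraction
commuting with the shift. -/
theorem gram_le_of_contraction (hF : IsHInfty F) (hG : IsHInfty G)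
    {V : HardySpace K →L[ℂ] HardySpace L} (hV1 : ‖V‖ ≤ 1) (hV : CommutesShift V)
    (hVF : ∀ f, V (hF.mult f) = hG.mult f) :
    (∀ z ∈ Metric.ball (0 : ℂ) 1, gram (G z) ≤ gram (F z)) ∧
      (∀ k : ℕ, ∑ i ∈ Finset.range (k + 1), gram (taylorCoeff G i) ≤
        ∑ i ∈ Finset.range (k + 1), gram (taylorCoeff F i)) ∧
      ∀ k : ℕ, gram (toeplitzBlock G k) ≤ gram (toeplitzBlock F k) := by
  refine ⟨fun z hz => ?_, fun k => ?_, fun k => ?_⟩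
  · rw [mem_ball_zero_iff] at hz
    rw [gram_le_gram_iff]
    intro x
    rw [← hF.symbol_mult hz, ← hG.symbol_mult hz, symbol_apply, symbol_apply, ← hVF]
    refine (norm_evalCLM_map_le hV hz _).trans ?_
    exact mul_le_of_le_one_left (norm_nonneg _) hV1
  · rw [sum_gram_le_sum_gram_iff]
    intro x
    simp_rw [hF.taylorCoeff_apply, hG.taylorCoeff_apply, ← hVF]
    exact sum_norm_sq_map_le hV hV1 _ _
  · rw [gram_le_gram_iff]
    intro u
    refine (sq_le_sq₀ (norm_nonneg _) (norm_nonneg _)).1 ?_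
    rw [hF.norm_toeplitzBlock_sq, hG.norm_toeplitzBlock_sq, ← hVF]
    exact sum_norm_sq_map_le hV hV1 _ _

end Outer

/-! ### The angular derivative of the Poisson kernel -/

namespace PoissonDeriv

/-- The Poisson kernel of the unit disk at the point `r` of the real axis. -/
def kernel (r s : ℝ) : ℝ := (1 - r ^ 2) / (1 - 2 * r * Real.cos s + r ^ 2)

/-- The angular derivative of the Poisson kernel. -/
def kernelDeriv (r s : ℝ) : ℝ :=
  -((1 - r ^ 2) * (2 * r * Real.sin s)) / (1 - 2 * r * Real.cos s + r ^ 2) ^ 2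

variable {r : ℝ}

theorem denom_pos (hr0 : 0 ≤ r) (hr : r < 1) (s : ℝ) : 0 < 1 - 2 * r * Real.cos s + r ^ 2 := by
  nlinarith [Real.cos_le_one s, mul_nonneg hr0 (sub_nonneg.2 (Real.cos_le_one s)),
    mul_pos (sub_pos.2 hr) (sub_pos.2 hr)]

theorem hasDerivAt_kernel (hr0 : 0 ≤ r) (hr : r < 1) (s : ℝ) :
    HasDerivAt (kernel r) (kernelDeriv r s) s := by
  have h1 : HasDerivAt (fun s => 1 - 2 * r * Real.cos s + r ^ 2) (2 * r * Real.sin s) s := by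
    have := (((Real.hasDerivAt_cos s).const_mul (2 * r)).const_sub 1).add_const (r ^ 2)
    simpa using this
  have h2 := (hasDerivAt_const s (1 - r ^ 2)).fun_div h1 (denom_pos hr0 hr s).ne'
  refine h2.congr_deriv ?_
  simp [kernelDeriv]

theorem continuous_kernelDeriv (hr0 : 0 ≤ r) (hr : r < 1) : Continuous (kernelDeriv r) := by
  unfold kernelDeriv
  exact Continuous.div (by fun_prop) (by fun_prop) fun s => pow_ne_zero 2 (denom_pos hr0 hr s).ne'

theorem kernel_neg_pi : kernel r (-Real.pi) = kernel r Real.pi := by simp [kernel]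

theorem kernel_pi (hr0 : 0 ≤ r) : kernel r Real.pi = (1 - r) / (1 + r) := by
  have : (1 + r) ≠ 0 := by positivity
  simp only [kernel, Real.cos_pi]
  rw [show 1 - 2 * r * -1 + r ^ 2 = (1 + r) ^ 2 by ring]
  field_simp
  ring

theorem integral_kernel_mul_pow (hr0 : 0 ≤ r) (hr : r < 1) (n : ℕ) :
    ∫ s in -Real.pi..Real.pi, (kernel r s : ℂ) * circleMap 0 1 s ^ n = 2 * Real.pi * (r : ℂ) ^ n := by
  have hd : DiffContOnCl ℂ (fun z : ℂ => z ^ n) (Metric.ball 0 1) :=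
    (differentiable_id.pow n).diffContOnCl
  have h := hd.circleAverage_poissonKernel_smul' (w := (r : ℂ))
    (by simpa [abs_of_nonneg hr0] using hr)
  rw [Real.circleAverage_def] at h
  have hk : ∀ s : ℝ, ((‖circleMap 0 1 s - 0‖ ^ 2 - ‖(r : ℂ) - 0‖ ^ 2) /
      ‖circleMap 0 1 s - 0 - ((r : ℂ) - 0)‖ ^ 2) • circleMap 0 1 s ^ n =
      (kernel r s : ℂ) * circleMap 0 1 s ^ n := fun s => by
    have h1 : ‖circleMap 0 1 s - (r : ℂ)‖ ^ 2 = 1 - 2 * r * Real.cos s + r ^ 2 := by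
      rw [← Complex.normSq_eq_norm_sq, Complex.normSq_apply]
      simp only [Complex.sub_re, Complex.sub_im, circleMap, zero_add, Complex.ofReal_one, one_mul,
        Complex.exp_ofReal_mul_I_re, Complex.exp_ofReal_mul_I_im, Complex.ofReal_re,
        Complex.ofReal_im]
      nlinarith [Real.sin_sq_add_cos_sq s]
    rw [sub_zero, sub_zero, h1, kernel, Complex.real_smul]
    simp
  simp_rw [hk] at h
  have hper : Function.Periodic (fun s : ℝ => (kernel r s : ℂ) * circleMap 0 1 s ^ n)
      (2 * Real.pi) := fun s => by
    simp only [kernel, Real.cos_add_two_pi]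
    rw [periodic_circleMap 0 1 s]
  have h2 := hper.intervalIntegral_add_eq (-Real.pi) 0
  rw [show -Real.pi + 2 * Real.pi = Real.pi by ring, zero_add] at h2
  rw [h2]
  rw [inv_smul_eq_iff₀ Real.two_pi_pos.ne'] at h
  rw [h, Complex.real_smul]
  push_cast
  rfl

theorem hasDerivAt_circleMap_pow (n : ℕ) (s : ℝ) :
    HasDerivAt (fun s : ℝ => circleMap 0 1 s ^ n) (Complex.I * n * circleMap 0 1 s ^ n) s := by
  refine ((hasDerivAt_circleMap 0 1 s).fun_pow n).congr_deriv ?_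
  cases n with
  | zero => simp
  | succ n =>
    rw [Nat.add_sub_cancel]
    ring

theorem integral_kernelDeriv_mul_pow (hr0 : 0 ≤ r) (hr : r < 1) (n : ℕ) :
    ∫ s in -Real.pi..Real.pi, (kernelDeriv r s : ℂ) * circleMap 0 1 s ^ n =
      -(2 * Real.pi * (Complex.I * n * (r : ℂ) ^ n)) := by
  have h := intervalIntegral.integral_mul_deriv_eq_deriv_mul (a := -Real.pi) (b := Real.pi)
    (u := fun s : ℝ => circleMap 0 1 s ^ n) (v := fun s : ℝ => (kernel r s : ℂ))
    (u' := fun s : ℝ => Complex.I * n * circleMap 0 1 s ^ n)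
    (v' := fun s : ℝ => (kernelDeriv r s : ℂ))
    (fun s _ => hasDerivAt_circleMap_pow n s)
    (fun s _ => (hasDerivAt_kernel hr0 hr s).ofReal_comp)
    (Continuous.intervalIntegrable (by fun_prop) _ _)
    ((Complex.continuous_ofReal.comp (continuous_kernelDeriv hr0 hr)).intervalIntegrable _ _)
  have h3 : circleMap 0 1 (-Real.pi) = circleMap 0 1 Real.pi := by
    have := periodic_circleMap 0 1 (-Real.pi)
    rwa [show -Real.pi + 2 * Real.pi = Real.pi by ring, eq_comm] at this
  rw [kernel_neg_pi, h3, sub_self, zero_sub] at h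
  have h4 : ∀ s : ℝ, Complex.I * n * circleMap 0 1 s ^ n * (kernel r s : ℂ) =
      Complex.I * n * ((kernel r s : ℂ) * circleMap 0 1 s ^ n) := fun s => by ring
  simp_rw [h4] at h
  rw [intervalIntegral.integral_const_mul, integral_kernel_mul_pow hr0 hr] at h
  simp_rw [mul_comm ((kernelDeriv r _ : ℝ) : ℂ)]
  rw [h]
  ring

theorem integral_kernel (hr0 : 0 ≤ r) (hr : r < 1) :
    ∫ s in -Real.pi..Real.pi, kernel r s = 2 * Real.pi := by
  have h := integral_kernel_mul_pow hr0 hr 0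
  simp only [pow_zero, mul_one] at h
  rw [intervalIntegral.integral_ofReal] at h
  exact_mod_cast h

theorem integral_kernelDeriv (hr0 : 0 ≤ r) (hr : r < 1) :
    ∫ s in -Real.pi..Real.pi, kernelDeriv r s = 0 := by
  rw [intervalIntegral.integral_eq_sub_of_hasDerivAt (fun s _ => hasDerivAt_kernel hr0 hr s)
    ((continuous_kernelDeriv hr0 hr).intervalIntegrable _ _), kernel_neg_pi, sub_self]

theorem integral_id_mul_kernelDeriv (hr0 : 0 ≤ r) (hr : r < 1) :
    ∫ s in -Real.pi..Real.pi, s * kernelDeriv r s = 2 * Real.pi * kernel r Real.pi - 2 * Real.pi := by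
  have h := intervalIntegral.integral_mul_deriv_eq_deriv_mul (a := -Real.pi) (b := Real.pi)
    (u := fun s : ℝ => s) (v := kernel r) (u' := fun _ => 1) (v' := kernelDeriv r)
    (fun s _ => hasDerivAt_id s) (fun s _ => hasDerivAt_kernel hr0 hr s)
    (by simp) ((continuous_kernelDeriv hr0 hr).intervalIntegrable _ _)
  rw [h, kernel_neg_pi]
  simp only [one_mul]
  rw [integral_kernel hr0 hr]
  ring

/-- The kernel decreases away from `0` on the period, so its derivative has the sign opposite to
`s`. Hence the weight `|s|` times the absolute derivative has an explicit integral, which makes it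
behave like an approximate identity. -/
theorem abs_kernelDeriv_mul_abs (hr0 : 0 ≤ r) (hr : r < 1) {s : ℝ} (hs : s ∈ Set.Icc (-Real.pi) Real.pi) :
    |kernelDeriv r s| * |s| = -(s * kernelDeriv r s) := by
  rw [← abs_mul, mul_comm, abs_of_nonpos]
  have hsin : 0 ≤ s * Real.sin s := by
    rcases le_total 0 s with h | h
    · exact mul_nonneg h (Real.sin_nonneg_of_nonneg_of_le_pi h hs.2)
    · exact mul_nonneg_of_nonpos_of_nonpos h (Real.sin_nonpos_of_nonpos_of_neg_pi_le h hs.1)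
  have h1 : 0 ≤ 1 - r ^ 2 := by nlinarith
  rw [kernelDeriv, neg_div, mul_neg, neg_nonpos, mul_div_assoc']
  refine div_nonneg ?_ (sq_nonneg _)
  calc (0 : ℝ) ≤ (1 - r ^ 2) * (2 * r) * (s * Real.sin s) := by positivity
    _ = _ := by ring

theorem abs_kernelDeriv_le (hr0 : 1 / 2 ≤ r) (hr : r < 1) {δ s : ℝ} (hδ0 : 0 < δ)
    (hδ : δ ≤ |s|) (hs : |s| ≤ Real.pi) :
    |kernelDeriv r s| ≤ 2 * (1 - r ^ 2) / (1 - Real.cos δ) ^ 2 := by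
  have hcos : Real.cos s ≤ Real.cos δ := by
    rw [← Real.cos_abs s]
    exact Real.cos_le_cos_of_nonneg_of_le_pi hδ0.le hs hδ
  have hc : 0 < 1 - Real.cos δ := by
    have := Real.cos_lt_cos_of_nonneg_of_le_pi le_rfl (hδ.trans hs) hδ0
    rw [Real.cos_zero] at this
    linarith
  have h1 : 0 ≤ 1 - r ^ 2 := by nlinarith
  -- The denominator equals `(1 - r) ^ 2 + 2 * r * (1 - cos s)`, and `2 * r ≥ 1`.
  have hden : 1 - Real.cos δ ≤ 1 - 2 * r * Real.cos s + r ^ 2 := by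
    nlinarith [sq_nonneg (1 - r), Real.cos_le_one s, Real.cos_le_one δ]
  rw [kernelDeriv, abs_div, abs_neg, abs_of_nonneg (sq_nonneg (_ : ℝ)), abs_mul, abs_of_nonneg h1,
    abs_mul, abs_of_nonneg (by linarith : 0 ≤ 2 * r)]
  refine div_le_div₀ (by positivity) ?_ (by positivity) (pow_le_pow_left₀ hc.le hden 2)
  calc (1 - r ^ 2) * (2 * r * |Real.sin s|) ≤ (1 - r ^ 2) * (2 * 1 * 1) := by
        gcongr
        exact Real.abs_sin_le_one s
    _ = _ := by ring

end PoissonDeriv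

open PoissonDeriv

/-! ### Abel summation of a differentiated series -/

section Fatou

variable {E : Type*} [NormedAddCommGroup E] [InnerProductSpace ℂ E] [CompleteSpace E]

theorem integral_kernelDeriv_smul_tsum {r : ℝ} (hr0 : 0 ≤ r) (hr : r < 1) {a : ℕ → E}
    (ha : Summable fun n => ‖a n‖) :
    ∫ s in -Real.pi..Real.pi, kernelDeriv r s • ∑' n, circleMap 0 1 s ^ n • a n =
      -(2 * Real.pi : ℝ) • ∑' n : ℕ, (Complex.I * n * (r : ℂ) ^ n) • a n := by
  obtain ⟨M, hM⟩ := isCompact_Icc.exists_bound_of_continuousOn (s := Set.Icc (-Real.pi) Real.pi)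
    (continuous_kernelDeriv hr0 hr).continuousOn
  have hk := continuous_kernelDeriv hr0 hr
  have h1 : HasSum (fun n => ∫ s in -Real.pi..Real.pi, kernelDeriv r s • circleMap 0 1 s ^ n • a n)
      (∫ s in -Real.pi..Real.pi, kernelDeriv r s • ∑' n, circleMap 0 1 s ^ n • a n) := by
    refine intervalIntegral.hasSum_integral_of_dominated_convergence (fun n _ => M * ‖a n‖)
      (fun n => Continuous.aestronglyMeasurable (by fun_prop)) (fun n => ae_of_all _ fun s hs => ?_)
      (ae_of_all _ fun s _ => ha.mul_left M) (by simp) (ae_of_all _ fun s _ => ?_)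
    · rw [Set.uIoc_of_le (by linarith [Real.pi_pos])] at hs
      rw [norm_smul, norm_smul, norm_pow, norm_circleMap_one, one_pow, one_mul]
      gcongr
      exact hM s (Set.Ioc_subset_Icc_self hs)
    · exact (summable_circleMap_pow_smul ha s).hasSum.const_smul _
  rw [← h1.tsum_eq, ← tsum_const_smul'']
  refine tsum_congr fun n => ?_
  have h2 : ∀ s : ℝ, kernelDeriv r s • circleMap 0 1 s ^ n • a n =
      ((kernelDeriv r s : ℂ) * circleMap 0 1 s ^ n) • a n := fun s => by
    rw [mul_smul, Complex.coe_smul]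
  simp_rw [h2]
  rw [intervalIntegral.integral_smul_const, integral_kernelDeriv_mul_pow hr0 hr, ← Complex.coe_smul,
    smul_smul]
  push_cast
  ring_nf

/-- Abel summability of the differentiated Fourier series at a point of differentiability. -/
theorem tendsto_tsum_deriv_of_hasDerivAt {a : ℕ → E} (ha : Summable fun n => ‖a n‖) {D : E}
    (hD : HasDerivAt (fun s : ℝ => ∑' n, circleMap 0 1 s ^ n • a n) D 0) :
    Tendsto (fun r : ℝ => ∑' n : ℕ, (Complex.I * n * (r : ℂ) ^ n) • a n) (𝓝[<] 1) (𝓝 D) := by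
  set B : ℝ → E := fun s => ∑' n, circleMap 0 1 s ^ n • a n with hB
  have hBc : Continuous B := continuous_tsum_circleMap_pow_smul ha
  -- The remainder after the affine part. Against the kernel derivative the constant integrates to
  -- zero and the linear term gives a multiple of `D` tending to `D`, so only the integral of `R`,
  -- which is `o(s)` at `0`, remains to be estimated.
  set R : ℝ → E := fun s => B s - B 0 - s • D with hR
  have hRc : Continuous R := by fun_prop
  have hpi := Real.pi_pos
  have hev : ∀ᶠ r : ℝ in 𝓝[<] 1, 1 / 2 < r ∧ r < 1 := by
    filter_upwards [Ioo_mem_nhdsLT (by norm_num : (1 / 2 : ℝ) < 1)] with r hr using hr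
  have hrep : ∀ᶠ r : ℝ in 𝓝[<] 1,
      (1 - (1 - r) / (1 + r)) • D -
        (2 * Real.pi)⁻¹ • ∫ s in -Real.pi..Real.pi, kernelDeriv r s • R s =
      ∑' n : ℕ, (Complex.I * n * (r : ℂ) ^ n) • a n := by
    filter_upwards [hev] with r hr
    have hr0 : 0 ≤ r := by linarith [hr.1]
    have hk := continuous_kernelDeriv hr0 hr.2
    have h1 : ∫ s in -Real.pi..Real.pi, kernelDeriv r s • R s =
        (∫ s in -Real.pi..Real.pi, kernelDeriv r s • B s) -
          (∫ s in -Real.pi..Real.pi, kernelDeriv r s) • B 0 -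
          (∫ s in -Real.pi..Real.pi, s * kernelDeriv r s) • D := by
      rw [← intervalIntegral.integral_smul_const, ← intervalIntegral.integral_smul_const,
        ← intervalIntegral.integral_sub, ← intervalIntegral.integral_sub]
      · refine intervalIntegral.integral_congr fun s _ => ?_
        simp only [hR, smul_sub, smul_smul, mul_comm s]
      all_goals exact Continuous.intervalIntegrable (by fun_prop) _ _
    rw [h1, integral_kernelDeriv hr0 hr.2, integral_id_mul_kernelDeriv hr0 hr.2, kernel_pi hr0,
      integral_kernelDeriv_smul_tsum hr0 hr.2 ha]
    rw [zero_smul, sub_zero, smul_sub, smul_smul, smul_smul]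
    have h2 : (2 * Real.pi)⁻¹ * -(2 * Real.pi) = -1 := by field_simp
    have h3 : (2 * Real.pi)⁻¹ * (2 * Real.pi * ((1 - r) / (1 + r)) - 2 * Real.pi) =
        -(1 - (1 - r) / (1 + r)) := by field_simp; ring
    rw [h2, h3]
    module
  refine Tendsto.congr' hrep ?_
  have hlim1 : Tendsto (fun r : ℝ => (1 - (1 - r) / (1 + r)) • D) (𝓝[<] 1) (𝓝 D) := by
    have : ContinuousAt (fun r : ℝ => (1 - (1 - r) / (1 + r)) • D) 1 := by
      have h : ContinuousAt (fun r : ℝ => (1 - r) / (1 + r)) 1 :=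
        ContinuousAt.div (by fun_prop) (by fun_prop) (by norm_num)
      exact (continuousAt_const.sub h).smul continuousAt_const
    simpa using this.tendsto.mono_left nhdsWithin_le_nhds
  suffices hlim2 : Tendsto (fun r : ℝ => ∫ s in -Real.pi..Real.pi, kernelDeriv r s • R s)
      (𝓝[<] 1) (𝓝 0) by
    simpa using hlim1.sub (hlim2.const_smul (2 * Real.pi)⁻¹)
  rw [Metric.tendsto_nhds]
  intro ε hε
  obtain ⟨M, hM⟩ := isCompact_Icc.exists_bound_of_continuousOn (s := Set.Icc (-Real.pi) Real.pi)
    hRc.continuousOn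
  have hM0 : 0 ≤ M := (norm_nonneg _).trans (hM 0 ⟨by linarith, by linarith⟩)
  -- The integral of `-(s * kernelDeriv r s)` is at most `2 * π`, so the part near `0` contributes
  -- at most `ε / 2`.
  set ε' := ε / (4 * Real.pi) with hε'
  have hε'0 : 0 < ε' := by positivity
  have hlittle : ∀ᶠ s : ℝ in 𝓝 0, ‖R s‖ ≤ ε' * |s| := by
    have := (hasDerivAt_iff_isLittleO.1 hD).def hε'0
    simpa [hR] using this
  obtain ⟨δ₀, hδ₀, hδR⟩ := Metric.eventually_nhds_iff.1 hlittle
  set δ := min (δ₀ / 2) 1 with hδ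
  have hδ0 : 0 < δ := by positivity
  have hc : 0 < 1 - Real.cos δ := by
    have := Real.cos_lt_cos_of_nonneg_of_le_pi le_rfl
      ((min_le_right _ _).trans (by linarith [Real.pi_gt_three])) hδ0
    rw [Real.cos_zero] at this
    linarith
  have hsmall : ∀ᶠ r : ℝ in 𝓝[<] 1,
      2 * Real.pi * (2 * (1 - r ^ 2) / (1 - Real.cos δ) ^ 2 * M) < ε / 2 := by
    have hcont : Continuous fun r : ℝ =>
        2 * Real.pi * (2 * (1 - r ^ 2) / (1 - Real.cos δ) ^ 2 * M) := by fun_prop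
    have := (hcont.tendsto 1).mono_left (nhdsWithin_le_nhds (s := Set.Iio 1))
    simp only [one_pow, sub_self, mul_zero, zero_div, zero_mul] at this
    exact this.eventually (gt_mem_nhds (by positivity))
  filter_upwards [hev, hsmall] with r hr hrs
  have hr0 : 0 ≤ r := by linarith [hr.1]
  have hk := continuous_kernelDeriv hr0 hr.2
  set η := 2 * (1 - r ^ 2) / (1 - Real.cos δ) ^ 2 with hη
  have hη0 : 0 ≤ η := by
    have : 0 ≤ 1 - r ^ 2 := by nlinarith [hr.1, hr.2]
    positivity
  have hpt : ∀ s ∈ Set.Ioc (-Real.pi) Real.pi,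
      ‖kernelDeriv r s • R s‖ ≤ ε' * -(s * kernelDeriv r s) + η * M := fun s hs => by
    have hs' := Set.Ioc_subset_Icc_self hs
    rw [norm_smul, Real.norm_eq_abs, ← abs_kernelDeriv_mul_abs hr0 hr.2 hs']
    -- Near `0` the remainder is small relative to `|s|`; away from `0` it is merely bounded, but
    -- the kernel derivative is uniformly small as `r → 1`.
    rcases lt_or_ge |s| δ with h | h
    · have h1 : ‖R s‖ ≤ ε' * |s| := hδR (by
        rw [Real.dist_eq, sub_zero]
        exact h.trans_le ((min_le_left _ _).trans (by linarith)))
      calc |kernelDeriv r s| * ‖R s‖ ≤ |kernelDeriv r s| * (ε' * |s|) := by gcongr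
        _ = ε' * (|kernelDeriv r s| * |s|) := by ring
        _ ≤ _ := le_add_of_nonneg_right (by positivity)
    · have h1 := abs_kernelDeriv_le hr.1.le hr.2 hδ0 h (abs_le.2 hs')
      calc |kernelDeriv r s| * ‖R s‖ ≤ η * M := by
            gcongr
            exact hM s hs'
        _ ≤ _ := le_add_of_nonneg_left (by positivity)
  rw [dist_zero_right]
  have hle := intervalIntegral.norm_integral_le_of_norm_le (by linarith : -Real.pi ≤ Real.pi)
    (ae_of_all volume hpt) (Continuous.intervalIntegrable (by fun_prop) _ _)
  refine hle.trans_lt ?_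
  rw [intervalIntegral.integral_add (Continuous.intervalIntegrable (by fun_prop) _ _)
    (by simp), intervalIntegral.integral_const_mul, intervalIntegral.integral_neg,
    integral_id_mul_kernelDeriv hr0 hr.2, intervalIntegral.integral_const]
  have hkp : 0 ≤ kernel r Real.pi := by
    rw [kernel_pi hr0]
    exact div_nonneg (by linarith [hr.2]) (by linarith)
  have h5 : ε' * -(2 * Real.pi * kernel r Real.pi - 2 * Real.pi) ≤ ε / 2 := by
    calc ε' * -(2 * Real.pi * kernel r Real.pi - 2 * Real.pi) ≤ ε' * (2 * Real.pi) := by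
          gcongr
          nlinarith
      _ = ε / 2 := by rw [hε']; field_simp; ring
  rw [smul_eq_mul, show Real.pi - -Real.pi = 2 * Real.pi by ring]
  linarith

end Fatou

open HardySpace

/-- The exceptional set is invariant under translation by multiples of `T`, and `Ioc 0 T` is a
fundamental domain for these translations. -/
theorem ae_of_periodic_of_ae_restrict {p : ℝ → Prop} {T : ℝ} (hT : 0 < T)
    (hp : ∀ t, p (t + T) ↔ p t) (h : ∀ᵐ t ∂volume.restrict (Set.Ioc 0 T), p t) : ∀ᵐ t, p t := by
  have hfd := isAddFundamentalDomain_Ioc hT 0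
  rw [zero_add] at hfd
  have hz : ∀ (k : ℤ) (t : ℝ), p (t + k * T) ↔ p t := by
    intro k
    induction k using Int.induction_on with
    | zero => simp
    | succ k ih =>
      intro t
      rw [show t + (((k : ℤ) + 1 : ℤ) : ℝ) * T = t + ((k : ℤ) : ℝ) * T + T by push_cast; ring, hp, ih]
    | pred k ih =>
      intro t
      rw [← hp, show t + ((-(k : ℤ) - 1 : ℤ) : ℝ) * T + T = t + ((-(k : ℤ) : ℤ) : ℝ) * T by
        push_cast; ring, ih]
  rw [ae_iff]
  refine hfd.measure_zero_of_invariant _ (fun g => ?_) ?_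
  · obtain ⟨g, k, rfl⟩ := g
    ext t
    rw [Set.mem_vadd_set_iff_neg_vadd_mem]
    simp only [Set.mem_ofPred_eq, not_iff_not, AddSubgroup.vadd_def, vadd_eq_add, zsmul_eq_mul,
      NegMemClass.coe_neg]
    rw [← hz k]
    ring_nf
  · rw [ae_iff, Measure.restrict_apply' measurableSet_Ioc] at h
    exact h

/-! ### Radial boundary values of Hardy space functions -/

section Boundary

variable {E : Type*} [NormedAddCommGroup E] [InnerProductSpace ℂ E] [CompleteSpace E]

/-- Lebesgue measure on a period of the circle. -/
abbrev arcMeasure : Measure ℝ := volume.restrict (Set.Ioc 0 (2 * Real.pi))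

omit [CompleteSpace E] in
theorem memLp_character (n : ℕ) (x : E) :
    MemLp (fun t : ℝ => ((Real.sqrt (2 * Real.pi) : ℂ)⁻¹ * circleMap 0 1 t ^ n) • x) 2 arcMeasure := by
  refine MemLp.of_bound (Continuous.aestronglyMeasurable (by fun_prop))
    (‖(Real.sqrt (2 * Real.pi) : ℂ)⁻¹‖ * ‖x‖) (ae_of_all _ fun t => ?_)
  rw [norm_smul, norm_mul, norm_pow, norm_circleMap_one, one_pow, mul_one]

/-- The normalised `E`-valued characters of the circle. -/
def characterLinear (E : Type*) [NormedAddCommGroup E] [InnerProductSpace ℂ E] [CompleteSpace E]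
    (n : ℕ) : E →ₗ[ℂ] Lp E 2 arcMeasure where
  toFun x := (memLp_character n x).toLp _
  map_add' x y := by
    rw [← MemLp.toLp_add]
    congr 1
    ext t
    simp [smul_add]
  map_smul' c x := by
    rw [RingHom.id_apply, ← MemLp.toLp_const_smul]
    congr 1
    ext t
    simp only [Pi.smul_apply]
    rw [smul_comm]

theorem inner_characterLinear (n m : ℕ) (x y : E) :
    inner ℂ (characterLinear E n x) (characterLinear E m y) =
      if n = m then inner ℂ x y else (0 : ℂ) := by
  have h1 : inner ℂ (characterLinear E n x) (characterLinear E m y) =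
      ∫ t, ((2 * Real.pi : ℂ)⁻¹ * inner ℂ x y) *
        ((starRingEnd ℂ) (circleMap 0 1 t ^ n) * circleMap 0 1 t ^ m) ∂arcMeasure := by
    rw [L2.inner_def]
    refine integral_congr_ae ?_
    filter_upwards [(memLp_character n x).coeFn_toLp, (memLp_character m y).coeFn_toLp]
      with t hn hm
    simp only [characterLinear, LinearMap.coe_mk, AddHom.coe_mk]
    rw [hn, hm, inner_smul_left, inner_smul_right, map_mul, map_inv₀, Complex.conj_ofReal]
    have h2 : (Real.sqrt (2 * Real.pi) : ℂ)⁻¹ * (Real.sqrt (2 * Real.pi) : ℂ)⁻¹ =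
        (2 * Real.pi : ℂ)⁻¹ := by
      rw [← mul_inv, ← Complex.ofReal_mul, Real.mul_self_sqrt Real.two_pi_pos.le]
      push_cast
      rfl
    rw [← h2]
    ring
  have h3 := integral_circleMap_pow n m
  rw [intervalIntegral.integral_of_le Real.two_pi_pos.le] at h3
  rw [h1, integral_const_mul, h3]
  have hpi : (2 * Real.pi : ℂ) ≠ 0 := by
    exact_mod_cast Real.two_pi_pos.ne'
  split_ifs
  · field_simp
  · simp

/-- The normalised `E`-valued characters of the circle as isometries. -/
def character (E : Type*) [NormedAddCommGroup E] [InnerProductSpace ℂ E] [CompleteSpace E]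
    (n : ℕ) : E →ₗᵢ[ℂ] Lp E 2 arcMeasure :=
  (characterLinear E n).isometryOfInner fun x y => by
    rw [inner_characterLinear, if_pos rfl]

theorem orthogonalFamily_character : OrthogonalFamily ℂ (fun _ : ℕ => E) (character E) :=
  fun n m hnm x y => by
    have := inner_characterLinear n m x y
    rwa [if_neg hnm] at this

theorem integral_circleMap_pow_interval (n : ℕ) (hn : n ≠ 0) (t : ℝ) :
    ∫ s in (0 : ℝ)..t, circleMap 0 1 s ^ n = (Complex.I * n)⁻¹ * (circleMap 0 1 t ^ n - 1) := by
  have hIn : (Complex.I * n : ℂ) ≠ 0 := mul_ne_zero Complex.I_ne_zero (by exact_mod_cast hn)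
  have h := intervalIntegral.integral_eq_sub_of_hasDerivAt (a := 0) (b := t)
    (fun s _ => PoissonDeriv.hasDerivAt_circleMap_pow n s) (Continuous.intervalIntegrable (by fun_prop) _ _)
  rw [intervalIntegral.integral_const_mul] at h
  rw [eq_inv_mul_iff_mul_eq₀ hIn, h]
  simp [circleMap]

/-- The coefficients of the angular primitive of a function in the Hardy space. -/
def primitiveCoeff (f : HardySpace E) (n : ℕ) : E := (Complex.I * n : ℂ)⁻¹ • f n

-- By the inequality between products and squares, `n⁻¹ * ‖f n‖` is at most `n⁻² + ‖f n‖ ^ 2`.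
-- Absolute summability makes the primitive a continuous function, to which the Abel summation
-- result applies.
omit [CompleteSpace E] in
theorem summable_norm_primitiveCoeff (f : HardySpace E) :
    Summable fun n => ‖primitiveCoeff f n‖ := by
  have h1 : Summable fun n : ℕ => 1 / (n : ℝ) ^ 2 := Real.summable_one_div_nat_pow.2 one_lt_two
  refine Summable.of_nonneg_of_le (fun n => norm_nonneg _) (fun n => ?_)
    (h1.add (summable_norm_sq f))
  rw [primitiveCoeff, norm_smul, norm_inv, norm_mul, Complex.norm_I, one_mul, Complex.norm_natCast,
    one_div, ← inv_pow]
  nlinarith [sq_nonneg ((n : ℝ)⁻¹ - ‖f n‖), sq_nonneg ((n : ℝ)⁻¹), sq_nonneg ‖f n‖]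

/-- The angular primitive of the boundary function of an element of the Hardy space. -/
theorem exists_boundary_function (f : HardySpace E) :
    ∃ φ : ℝ → E, IntervalIntegrable φ volume 0 (2 * Real.pi) ∧
      ∀ t ∈ Set.Icc 0 (2 * Real.pi), ∫ s in (0 : ℝ)..t, φ s =
        t • f 0 + ((∑' n, circleMap 0 1 t ^ n • primitiveCoeff f n) - ∑' n, primitiveCoeff f n) := by
  set c : ℂ := (Real.sqrt (2 * Real.pi) : ℂ) with hc
  have hc0 : c ≠ 0 := by
    rw [hc]
    exact_mod_cast (Real.sqrt_pos.2 Real.two_pi_pos).ne'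
  set g : Lp E 2 arcMeasure := orthogonalFamily_character.linearIsometry f with hg
  have hgs : HasSum (fun n => character E n (f n)) g :=
    orthogonalFamily_character.hasSum_linearIsometry f
  have hgi : Integrable g arcMeasure :=
    (Lp.memLp g).integrable (by norm_num)
  refine ⟨fun t => c • g t, ?_, fun t ht => ?_⟩
  · rw [intervalIntegrable_iff_integrableOn_Ioc_of_le Real.two_pi_pos.le]
    exact hgi.smul c
  have hsub : Set.Ioc 0 t ∩ Set.Ioc 0 (2 * Real.pi) = Set.Ioc 0 t :=
    Set.inter_eq_left.2 (Set.Ioc_subset_Ioc_right ht.2)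
  have hres : arcMeasure.restrict (Set.Ioc 0 t) = volume.restrict (Set.Ioc 0 t) := by
    rw [Measure.restrict_restrict measurableSet_Ioc, hsub]
  have hsum := summable_norm_primitiveCoeff f
  refine ext_inner_left ℂ fun y => ?_
  -- Integration over `(0, t]` followed by pairing with `y` is the inner product in `L²` with the
  -- indicator function times `y`, so it may be applied termwise to the orthogonal series of `g`.
  have h1 : HasSum (fun n => c * inner ℂ y (∫ s in Set.Ioc 0 t, character E n (f n) s))
      (inner ℂ y (∫ s in (0 : ℝ)..t, c • g s)) := by
    have h := (hgs.mapL (innerSL ℂ (indicatorConstLp 2 (measurableSet_Ioc (a := 0) (b := t))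
      (measure_ne_top arcMeasure _) y))).mul_left c
    simp only [innerSL_apply_apply, L2.inner_indicatorConstLp_eq_inner_setIntegral, hres] at h
    rw [intervalIntegral.integral_of_le ht.1, integral_smul, inner_smul_right]
    exact h
  -- For `n = 0` the inverse of zero makes `primitiveCoeff f 0` vanish; the primitive of the mean is
  -- the separate term `t • f 0`.
  have h2 : ∀ n, c * inner ℂ y (∫ s in Set.Ioc 0 t, character E n (f n) s) =
      inner ℂ y ((if n = 0 then t • f 0 else 0) +
        (circleMap 0 1 t ^ n • primitiveCoeff f n - primitiveCoeff f n)) := fun n => by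
    have h3 : ∫ s in Set.Ioc 0 t, character E n (f n) s =
        ∫ s in Set.Ioc 0 t, (c⁻¹ * circleMap 0 1 s ^ n) • f n := by
      rw [← hres]
      exact integral_congr_ae (ae_restrict_of_ae (memLp_character n (f n)).coeFn_toLp)
    rw [h3, integral_smul_const, integral_const_mul, ← intervalIntegral.integral_of_le ht.1,
      ← inner_smul_right, smul_smul, mul_inv_cancel_left₀ hc0]
    congr 1
    rcases eq_or_ne n 0 with rfl | hn
    · simp
    · rw [integral_circleMap_pow_interval n hn, if_neg hn, zero_add, primitiveCoeff, mul_comm,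
        mul_smul, sub_smul, one_smul]
  simp_rw [h2] at h1
  refine h1.unique (ContinuousLinearMap.hasSum (innerSL ℂ y) ?_)
  exact (hasSum_ite_eq 0 (t • f 0)).add
    ((summable_circleMap_pow_smul hsum t).hasSum.sub hsum.of_norm.hasSum)

/-- A rotation moves `t` to `0`. The differentiated series of the primitive at radius `r` is then
the value of `f` minus its constant coefficient, which the primitive does not see. -/
theorem exists_hasRadialLimit_of_hasDerivAt (f : HardySpace E) {t : ℝ} {D : E}
    (hD : HasDerivAt (fun s : ℝ => ∑' n, circleMap 0 1 s ^ n • primitiveCoeff f n) D t) :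
    HasRadialLimit (fun z => evalCLM E z f) t (D + f 0) := by
  set a : ℕ → E := fun n => circleMap 0 1 t ^ n • primitiveCoeff f n with ha
  have hsum : Summable fun n => ‖a n‖ := by
    simpa [ha, norm_smul] using summable_norm_primitiveCoeff f
  have hmul : ∀ s : ℝ, circleMap 0 1 (t + s) = circleMap 0 1 s * circleMap 0 1 t := fun s => by
    simp only [circleMap, Complex.ofReal_add, add_mul, Complex.exp_add, zero_add, Complex.ofReal_one,
      one_mul]
    exact mul_comm _ _
  have hD' : HasDerivAt (fun s : ℝ => ∑' n, circleMap 0 1 s ^ n • a n) D 0 := by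
    have h1 : HasDerivAt (fun s : ℝ => ∑' n, circleMap 0 1 s ^ n • primitiveCoeff f n) D (t + 0) := by
      rwa [add_zero]
    have h2 := h1.comp_const_add t 0
    simpa only [hmul, mul_pow, mul_smul] using h2
  have h := (tendsto_tsum_deriv_of_hasDerivAt hsum hD').add_const (f 0)
  refine Tendsto.congr' ?_ h
  filter_upwards [Ioo_mem_nhdsLT (zero_lt_one' ℝ)] with r hr
  have hz := norm_circleMap_lt_one hr.1.le hr.2 t
  have h3 := (hasSum_nat_add_iff' 1).2 (hasSum_evalCLM hz f)
  simp only [Finset.range_one, Finset.sum_singleton, pow_zero, one_smul] at h3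
  have h4 : HasSum (fun n : ℕ => (Complex.I * n * (r : ℂ) ^ n) • a n)
      (evalCLM E (circleMap 0 r t) f - f 0) := by
    rw [← hasSum_nat_add_iff' 1]
    simp only [Finset.range_one, Finset.sum_singleton, Nat.cast_zero, mul_zero, zero_mul, zero_smul,
      sub_zero]
    refine h3.congr_fun fun n => ?_
    have hIn : (Complex.I * ((n + 1 : ℕ) : ℂ)) ≠ 0 :=
      mul_ne_zero Complex.I_ne_zero (by exact_mod_cast n.succ_ne_zero)
    rw [ha, circleMap_eq_mul r t]
    simp only [primitiveCoeff, smul_smul]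
    congr 1
    field_simp
    ring
  rw [h4.tsum_eq, sub_add_cancel]

omit [InnerProductSpace ℂ E] [CompleteSpace E] in
theorem HasRadialLimit.add_two_pi_iff {f : ℂ → E} {t : ℝ} {a : E} :
    HasRadialLimit f (t + 2 * Real.pi) a ↔ HasRadialLimit f t a := by
  unfold HasRadialLimit
  have : ∀ r : ℝ, circleMap 0 r (t + 2 * Real.pi) = circleMap 0 r t := fun r =>
    periodic_circleMap 0 r t
  simp_rw [this]

/-- **Fatou's theorem** for the vector-valued Hardy space. -/
theorem ae_exists_hasRadialLimit (f : HardySpace E) :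
    ∀ᵐ t : ℝ, ∃ a, HasRadialLimit (fun z => evalCLM E z f) t a := by
  refine ae_of_periodic_of_ae_restrict Real.two_pi_pos
    (fun t => exists_congr fun a => HasRadialLimit.add_two_pi_iff) ?_
  obtain ⟨φ, hφ, hφB⟩ := exists_boundary_function f
  -- In the open interval the formula for the primitive holds on a neighbourhood of `t`, so Lebesgue
  -- differentiation of `φ` can be transferred to the series.
  rw [← restrict_Ioo_eq_restrict_Ioc, ae_restrict_iff' measurableSet_Ioo]
  filter_upwards [hφ.ae_hasDerivAt_integral] with t ht htm
  rw [Set.uIcc_of_le Real.two_pi_pos.le] at ht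
  have h1 := ht (Set.Ioo_subset_Icc_self htm) 0 ⟨le_rfl, Real.two_pi_pos.le⟩
  have h2 : HasDerivAt (fun s : ℝ => (∫ u in (0 : ℝ)..s, φ u) - s • f 0 + ∑' n, primitiveCoeff f n)
      (φ t - (1 : ℝ) • f 0) t :=
    (h1.sub ((hasDerivAt_id t).smul_const (f 0))).add_const _
  refine ⟨_, exists_hasRadialLimit_of_hasDerivAt f (h2.congr_of_eventuallyEq ?_)⟩
  filter_upwards [Ioo_mem_nhds htm.1 htm.2] with s hs
  rw [hφB s (Set.Ioo_subset_Icc_self hs)]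
  abel

end Boundary

open HardySpace

/-- The radial boundary value, wherever it exists. -/
def boundaryValue {E : Type*} [NormedAddCommGroup E] (f : ℂ → E) (t : ℝ) : E :=
  limUnder (𝓝[<] (1 : ℝ)) fun r : ℝ => f (circleMap 0 r t)

theorem HasRadialLimit.boundaryValue_eq {E : Type*} [NormedAddCommGroup E] {f : ℂ → E} {t : ℝ}
    {a : E} (h : HasRadialLimit f t a) : boundaryValue f t = a :=
  Tendsto.limUnder_eq h

theorem boundaryValue_add_two_pi {E : Type*} [NormedAddCommGroup E] (f : ℂ → E) (t : ℝ) :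
    boundaryValue f (t + 2 * Real.pi) = boundaryValue f t := by
  unfold boundaryValue
  have : ∀ r : ℝ, circleMap 0 r (t + 2 * Real.pi) = circleMap 0 r t := fun r =>
    periodic_circleMap 0 r t
  simp_rw [this]

/-! ### Equal boundary moduli and equal Gram forms of multiplication operators -/

section SameModulus

variable {E : Type*} [NormedAddCommGroup E] [InnerProductSpace ℂ E] [CompleteSpace E]
  {K : Type*} [NormedAddCommGroup K] [InnerProductSpace ℂ K] [CompleteSpace K]
  {L : Type*} [NormedAddCommGroup L] [InnerProductSpace ℂ L] [CompleteSpace L]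
  {F : ℂ → E →L[ℂ] K} {G : ℂ → E →L[ℂ] L}

theorem IsHInfty.ae_hasRadialLimit (hF : IsHInfty F) (x : E) :
    ∀ᵐ t : ℝ, HasRadialLimit (fun z => F z x) t (boundaryValue (fun z => F z x) t) := by
  filter_upwards [ae_exists_hasRadialLimit (hF.mult (monomial E 0 x))] with t ht
  obtain ⟨a, ha⟩ := ht
  have h : HasRadialLimit (fun z => F z x) t a := by
    refine Tendsto.congr' ?_ ha
    filter_upwards [Ioo_mem_nhdsLT (zero_lt_one' ℝ)] with r hr
    have hz := norm_circleMap_lt_one hr.1.le hr.2 t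
    rw [hF.evalCLM_mult hz, evalCLM_monomial hz, pow_zero, one_smul]
  rwa [h.boundaryValue_eq]

theorem IsHInfty.sameModulus_iff (hF : IsHInfty F) (hG : IsHInfty G) :
    SameModulus G F ↔ ∀ x y, ∀ᵐ t : ℝ,
      inner ℂ (boundaryValue (fun z => G z x) t) (boundaryValue (fun z => G z y) t) =
        inner ℂ (boundaryValue (fun z => F z x) t) (boundaryValue (fun z => F z y) t) := by
  refine forall_congr' fun x => forall_congr' fun y => ⟨fun h => ?_, fun h => ?_⟩
  · filter_upwards [h] with t ht
    obtain ⟨a, b, c, d, ha, hb, hc, hd, hcd⟩ := ht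
    rw [ha.boundaryValue_eq, hb.boundaryValue_eq, hc.boundaryValue_eq, hd.boundaryValue_eq, hcd]
  · filter_upwards [h, hF.ae_hasRadialLimit x, hF.ae_hasRadialLimit y, hG.ae_hasRadialLimit x,
      hG.ae_hasRadialLimit y] with t ht ha hb hc hd
    exact ⟨_, _, _, _, ha, hb, hc, hd, ht⟩

omit [CompleteSpace E] [CompleteSpace K] in
theorem IsHInfty.exists_norm_inner_le (hF : IsHInfty F) (x y : E) :
    ∃ C, ∀ z : ℂ, ‖z‖ < 1 → ‖(inner ℂ (F z x) (F z y) : ℂ)‖ ≤ C := by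
  obtain ⟨C, hC⟩ := hF.bounded
  refine ⟨C * ‖x‖ * (C * ‖y‖), fun z hz => (norm_inner_le_norm _ _).trans ?_⟩
  have hz' := hC z (mem_ball_zero_iff.2 hz)
  have hC0 := (norm_nonneg _).trans hz'
  exact mul_le_mul ((F z).le_of_opNorm_le hz' x) ((F z).le_of_opNorm_le hz' y) (norm_nonneg _)
    (by positivity)

omit [CompleteSpace E] [CompleteSpace K] in
theorem IsHInfty.continuous_apply_circleMap (hF : IsHInfty F) (x : E) {r : ℝ} (hr0 : 0 ≤ r) (hr : r < 1) :
    Continuous fun t => F (circleMap 0 r t) x :=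
  (continuous_comp_circleMap hF.holomorphic hr0 hr).clm_apply continuous_const

/-- The Gram form of the boundary values at a pair of vectors. -/
def boundaryInner (F : ℂ → E →L[ℂ] K) (x y : E) (t : ℝ) : ℂ :=
  inner ℂ (boundaryValue (fun z => F z x) t) (boundaryValue (fun z => F z y) t)

theorem IsHInfty.ae_tendsto_boundaryInner (hF : IsHInfty F) (x y : E) :
    ∀ᵐ t : ℝ, Tendsto (fun r : ℝ => inner ℂ (F (circleMap 0 r t) x) (F (circleMap 0 r t) y))
      (𝓝[<] 1) (𝓝 (boundaryInner F x y t)) := by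
  filter_upwards [hF.ae_hasRadialLimit x, hF.ae_hasRadialLimit y] with t hx hy
  exact Tendsto.inner hx hy

theorem IsHInfty.memLp_boundaryInner (hF : IsHInfty F) (x y : E) :
    MemLp (boundaryInner F x y) 2 arcMeasure := by
  obtain ⟨C, hC⟩ := hF.exists_norm_inner_le x y
  have hlim := ae_restrict_of_ae (s := Set.Ioc 0 (2 * Real.pi)) (hF.ae_tendsto_boundaryInner x y)
  refine MemLp.of_bound ?_ C ?_
  · have hseq : Tendsto (fun n : ℕ => 1 - 1 / ((n : ℝ) + 1)) atTop (𝓝[<] 1) := by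
      refine tendsto_nhdsWithin_iff.2 ⟨?_, Eventually.of_forall fun n => ?_⟩
      · simpa using tendsto_one_div_add_atTop_nhds_zero_nat.const_sub (1 : ℝ)
      · exact sub_lt_self (1 : ℝ) Nat.one_div_pos_of_nat
    refine aestronglyMeasurable_of_tendsto_ae atTop
      (f := fun (n : ℕ) t => inner ℂ (F (circleMap 0 (1 - 1 / ((n : ℝ) + 1)) t) x)
        (F (circleMap 0 (1 - 1 / ((n : ℝ) + 1)) t) y)) (fun n => ?_) ?_
    · have h0 : 0 ≤ 1 - 1 / ((n : ℝ) + 1) := by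
        rw [sub_nonneg, div_le_one (by positivity)]
        linarith [n.cast_nonneg (α := ℝ)]
      have h1 : 1 - 1 / ((n : ℝ) + 1) < 1 := sub_lt_self (1 : ℝ) Nat.one_div_pos_of_nat
      exact ((hF.continuous_apply_circleMap x h0 h1).inner
        (hF.continuous_apply_circleMap y h0 h1)).aestronglyMeasurable
    · filter_upwards [hlim] with t ht using ht.comp hseq
  · filter_upwards [hlim] with t ht
    refine le_of_tendsto ht.norm ?_
    filter_upwards [Ioo_mem_nhdsLT (zero_lt_one' ℝ)] with r hr
    exact hC _ (norm_circleMap_lt_one hr.1.le hr.2 t)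

/-- Both sides are the limit, as `r → 1`, of the mean over the circle of radius `r` of the inner
product of the two products with monomials: the left by dominated convergence, the right by the
limit of means in the Hardy space. Thus the Fourier coefficients of the boundary Gram form are
determined by the multiplication operator. -/
theorem IsHInfty.integral_boundaryInner (hF : IsHInfty F) (x y : E) (j k : ℕ) :
    ∫ t in (0 : ℝ)..2 * Real.pi, (starRingEnd ℂ) (circleMap 0 1 t ^ j) * circleMap 0 1 t ^ k *
        boundaryInner F x y t =
      2 * Real.pi * inner ℂ (hF.mult (monomial E j x)) (hF.mult (monomial E k y)) := by
  have h1 := tendsto_integral_inner_evalCLM (hF.mult (monomial E j x)) (hF.mult (monomial E k y))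
  refine tendsto_nhds_unique ?_ h1
  simp_rw [intervalIntegral.integral_of_le Real.two_pi_pos.le]
  obtain ⟨C, hC⟩ := hF.exists_norm_inner_le x y
  have heq : ∀ {r : ℝ}, 0 ≤ r → r < 1 → ∀ t,
      inner ℂ (evalCLM K (circleMap 0 r t) (hF.mult (monomial E j x)))
        (evalCLM K (circleMap 0 r t) (hF.mult (monomial E k y))) =
      (starRingEnd ℂ) (circleMap 0 r t ^ j) * circleMap 0 r t ^ k *
        inner ℂ (F (circleMap 0 r t) x) (F (circleMap 0 r t) y) := fun hr0 hr t => by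
    have hz := norm_circleMap_lt_one hr0 hr t
    rw [hF.evalCLM_mult hz, hF.evalCLM_mult hz, evalCLM_monomial hz, evalCLM_monomial hz, map_smul,
      map_smul, inner_smul_left, inner_smul_right]
    ring
  have hev := Ioo_mem_nhdsLT (zero_lt_one' ℝ)
  refine tendsto_integral_filter_of_norm_le_const ?_ ⟨C, ?_⟩ ?_
  · filter_upwards [hev] with r hr
    simp_rw [heq hr.1.le hr.2]
    exact (((Complex.continuous_conj.comp ((continuous_circleMap 0 r).pow j)).mul
      ((continuous_circleMap 0 r).pow k)).mul ((hF.continuous_apply_circleMap x hr.1.le hr.2).inner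
        (hF.continuous_apply_circleMap y hr.1.le hr.2))).aestronglyMeasurable
  · filter_upwards [hev] with r hr
    refine ae_of_all _ fun t => ?_
    have hz := norm_circleMap_lt_one hr.1.le hr.2 t
    rw [heq hr.1.le hr.2, norm_mul, norm_mul, RCLike.norm_conj, norm_pow, norm_pow]
    refine (mul_le_of_le_one_left (norm_nonneg _) ?_).trans (hC _ hz)
    exact mul_le_one₀ (pow_le_one₀ (norm_nonneg _) hz.le) (by positivity)
      (pow_le_one₀ (norm_nonneg _) hz.le)
  · filter_upwards [ae_restrict_of_ae (s := Set.Ioc 0 (2 * Real.pi))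
      (hF.ae_tendsto_boundaryInner x y)] with t ht
    have hcm : Tendsto (fun r : ℝ => (starRingEnd ℂ) (circleMap 0 r t ^ j) * circleMap 0 r t ^ k)
        (𝓝[<] 1) (𝓝 ((starRingEnd ℂ) (circleMap 0 1 t ^ j) * circleMap 0 1 t ^ k)) := by
      have hc : Continuous fun r : ℝ => circleMap 0 r t := by
        unfold circleMap
        fun_prop
      have : Continuous fun r : ℝ =>
          (starRingEnd ℂ) (circleMap 0 r t ^ j) * circleMap 0 r t ^ k :=
        (Complex.continuous_conj.comp (hc.pow j)).mul (hc.pow k)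
      exact (this.tendsto 1).mono_left nhdsWithin_le_nhds
    refine (hcm.mul ht).congr' ?_
    filter_upwards [hev] with r hr using (heq hr.1.le hr.2 t).symm

/-- Equal Gram forms of the boundary values mean equal Gram forms of the multiplication operators. -/
theorem IsHInfty.inner_mult_eq (hF : IsHInfty F) (hG : IsHInfty G) (h : SameModulus G F)
    (f g : HardySpace E) :
    inner ℂ (hG.mult f) (hG.mult g) = inner ℂ (hF.mult f) (hF.mult g) := by
  have hmon : ∀ j x k y, inner ℂ (hG.mult (monomial E j x)) (hG.mult (monomial E k y)) =
      inner ℂ (hF.mult (monomial E j x)) (hF.mult (monomial E k y)) := fun j x k y => by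
    have h2 : (2 * Real.pi : ℂ) ≠ 0 := by exact_mod_cast Real.two_pi_pos.ne'
    refine mul_left_cancel₀ h2 ?_
    rw [← hF.integral_boundaryInner, ← hG.integral_boundaryInner]
    refine intervalIntegral.integral_congr_ae ?_
    filter_upwards [(hF.sameModulus_iff hG).1 h x y] with t ht _
    rw [boundaryInner, ht, boundaryInner]
  have hop : hG.mult.adjoint ∘L hG.mult = hF.mult.adjoint ∘L hF.mult := by
    refine clm_ext fun k y => ?_
    ext j
    refine ext_inner_left ℂ fun x => ?_
    rw [← inner_monomial_left, ← inner_monomial_left, ContinuousLinearMap.comp_apply,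
      ContinuousLinearMap.comp_apply, ContinuousLinearMap.adjoint_inner_right,
      ContinuousLinearMap.adjoint_inner_right, hmon]
  rw [← ContinuousLinearMap.adjoint_inner_right, ← ContinuousLinearMap.adjoint_inner_right]
  exact congrArg (inner ℂ f) (DFunLike.congr_fun hop g)

/-- Parseval in `L²` of the circle. Differences `k - j` of natural numbers exhaust all integer
frequencies. -/
theorem ae_eq_zero_of_fourier {v : ℝ → ℂ} (hv : MemLp v 2 arcMeasure)
    (h : ∀ j k : ℕ, ∫ t in (0 : ℝ)..2 * Real.pi,
      (starRingEnd ℂ) (circleMap 0 1 t ^ j) * circleMap 0 1 t ^ k * v t = 0) :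
    ∀ᵐ t ∂arcMeasure, v t = 0 := by
  have hs := hasSum_sq_fourierCoeffOn Real.two_pi_pos hv
  have hcoef : ∀ n : ℤ, fourierCoeffOn Real.two_pi_pos v n = 0 := fun n => by
    rw [fourierCoeffOn_eq_integral]
    -- The frequency `-n` is split into the positive and negative parts of `n`, one of which is
    -- zero.
    have h1 : ∀ t : ℝ, fourier (-n) (t : AddCircle (2 * Real.pi - 0)) • v t =
        (starRingEnd ℂ) (circleMap 0 1 t ^ n.toNat) * circleMap 0 1 t ^ (-n).toNat * v t := fun t => by
      rw [fourier_coe_apply, smul_eq_mul]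
      congr 1
      simp only [circleMap, zero_add, Complex.ofReal_one, one_mul, ← Complex.exp_conj,
        map_mul, Complex.conj_ofReal, Complex.conj_I, ← Complex.exp_nat_mul, map_natCast,
        ← Complex.exp_add]
      congr 1
      have h2 : ((n.toNat : ℤ) - ((-n).toNat : ℤ)) = n := by omega
      have h3 : (n : ℂ) = (n.toNat : ℂ) - ((-n).toNat : ℂ) := by
        rw [← h2]
        push_cast
        simp
      have hpi : (Real.pi : ℂ) ≠ 0 := by exact_mod_cast Real.pi_ne_zero
      push_cast
      rw [h3]
      field_simp
      ring
    simp_rw [h1]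
    rw [h, smul_zero]
  simp_rw [hcoef] at hs
  simp only [norm_zero, ne_eq, OfNat.ofNat_ne_zero, not_false_eq_true, zero_pow] at hs
  have h4 := hs.unique hasSum_zero
  rw [smul_eq_zero, or_iff_right (by simp [Real.pi_ne_zero]),
    intervalIntegral.integral_of_le Real.two_pi_pos.le,
    integral_eq_zero_iff_of_nonneg (fun t => sq_nonneg _) (by exact_mod_cast hv.integrable_norm_pow (by norm_num))] at h4
  filter_upwards [h4] with t ht
  simpa using ht

theorem IsHInfty.sameModulus_of_inner_mult_eq (hF : IsHInfty F) (hG : IsHInfty G)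
    (h : ∀ f g, inner ℂ (hG.mult f) (hG.mult g) = inner ℂ (hF.mult f) (hF.mult g)) :
    SameModulus G F := by
  rw [hF.sameModulus_iff hG]
  intro x y
  refine ae_of_periodic_of_ae_restrict Real.two_pi_pos
    (fun t => by simp only [boundaryValue_add_two_pi]) ?_
  have hv := ae_eq_zero_of_fourier ((hG.memLp_boundaryInner x y).sub (hF.memLp_boundaryInner x y))
    fun j k => by
      have hc : Continuous fun t : ℝ => (starRingEnd ℂ) (circleMap 0 1 t ^ j) * circleMap 0 1 t ^ k :=
        (Complex.continuous_conj.comp ((continuous_circleMap 0 1).pow j)).mul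
          ((continuous_circleMap 0 1).pow k)
      have hint : ∀ {u : ℝ → ℂ}, MemLp u 2 arcMeasure → IntervalIntegrable
          (fun t => (starRingEnd ℂ) (circleMap 0 1 t ^ j) * circleMap 0 1 t ^ k * u t) volume 0
          (2 * Real.pi) := fun hu => by
        refine IntervalIntegrable.continuousOn_mul ?_ hc.continuousOn
        rw [intervalIntegrable_iff_integrableOn_Ioc_of_le Real.two_pi_pos.le]
        exact hu.integrable (by norm_num)
      simp only [Pi.sub_apply, mul_sub]
      rw [intervalIntegral.integral_sub (hint (hG.memLp_boundaryInner x y))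
        (hint (hF.memLp_boundaryInner x y)), hG.integral_boundaryInner, hF.integral_boundaryInner,
        h, sub_self]
  filter_upwards [hv] with t ht
  exact sub_eq_zero.1 ht

end SameModulus

namespace HardySpace

variable {K : Type*} [NormedAddCommGroup K] [InnerProductSpace ℂ K]

/-! ### The Wold decomposition of a shift invariant subspace -/

/-- The powers of the shift. -/
def shiftPow (K : Type*) [NormedAddCommGroup K] [InnerProductSpace ℂ K] (n : ℕ) :
    HardySpace K →ₗᵢ[ℂ] HardySpace K where
  toFun := (shift K)^[n]
  map_add' f g := by
    induction n with
    | zero => rfl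
    | succ n ih => rw [Function.iterate_succ_apply', Function.iterate_succ_apply',
        Function.iterate_succ_apply', ih, map_add]
  map_smul' c f := by
    induction n with
    | zero => rfl
    | succ n ih => rw [Function.iterate_succ_apply', Function.iterate_succ_apply', ih, map_smul]
  norm_map' f := norm_shift_iterate n f

/-- The wandering subspace `N ⊖ zN`. -/
def wandering (N : Submodule ℂ (HardySpace K)) : Submodule ℂ (HardySpace K) :=
  N ⊓ (N.map (shift K).toLinearMap)ᗮ

/-- Invariance under multiplication by the variable. -/
def ShiftInvariant (N : Submodule ℂ (HardySpace K)) : Prop := ∀ g ∈ N, shift K g ∈ N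

variable {N : Submodule ℂ (HardySpace K)}

theorem ShiftInvariant.iterate_mem (hS : ShiftInvariant N) (n : ℕ) {g : HardySpace K}
    (hg : g ∈ N) : (shift K)^[n] g ∈ N := by
  induction n with
  | zero => exact hg
  | succ n ih => rw [Function.iterate_succ_apply']; exact hS _ ih

theorem isClosed_wandering (hN : IsClosed (N : Set (HardySpace K))) :
    IsClosed (wandering N : Set (HardySpace K)) := by
  rw [wandering, Submodule.coe_inf]
  exact hN.inter (Submodule.isClosed_orthogonal _)

/-- Removing `n` common shifts leaves `w` against an element of `zN`, to which `w` is orthogonal. -/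
theorem inner_iterate_wandering (hS : ShiftInvariant N) {w g : HardySpace K} (hw : w ∈ wandering N)
    (hg : g ∈ N) {n m : ℕ} (h : n < m) :
    inner ℂ ((shift K)^[n] w) ((shift K)^[m] g) = 0 := by
  obtain ⟨k, rfl⟩ := Nat.exists_eq_add_of_lt h
  rw [add_assoc, Function.iterate_add_apply, inner_shift_iterate, Function.iterate_succ_apply']
  exact Submodule.inner_left_of_mem_orthogonal
    (Submodule.mem_map_of_mem (f := (shift K).toLinearMap) (hS.iterate_mem k hg)) hw.2

theorem ShiftInvariant.orthogonalFamily (hS : ShiftInvariant N) :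
    OrthogonalFamily ℂ (fun _ : ℕ => wandering N)
      fun n => (shiftPow K n).comp (wandering N).subtypeₗᵢ := by
  intro n m hnm w w'
  rcases hnm.lt_or_gt with h | h
  · exact inner_iterate_wandering hS w.2 w'.2.1 h
  · rw [← inner_conj_symm, map_eq_zero]
    exact inner_iterate_wandering hS w'.2 w.2.1 h

section Complete

variable [CompleteSpace K]

/-- The isometry of the Hardy space over the wandering subspace onto the invariant subspace. -/
def ShiftInvariant.wold (hS : ShiftInvariant N) : HardySpace (wandering N) →ₗᵢ[ℂ] HardySpace K :=
  hS.orthogonalFamily.linearIsometry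

theorem ShiftInvariant.hasSum_wold (hS : ShiftInvariant N) (u : HardySpace (wandering N)) :
    HasSum (fun n => (shift K)^[n] (u n : HardySpace K)) (hS.wold u) :=
  hS.orthogonalFamily.hasSum_linearIsometry u

theorem ShiftInvariant.wold_monomial (hS : ShiftInvariant N) (n : ℕ) (w : wandering N) :
    hS.wold (monomial _ n w) = (shift K)^[n] (w : HardySpace K) := by
  refine (hS.hasSum_wold _).unique ?_
  convert hasSum_ite_eq n ((shift K)^[n] (w : HardySpace K)) using 2 with m
  rw [monomial_coeff]
  split_ifs with h
  · rw [h]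
  · exact (shiftPow K m).map_zero

theorem ShiftInvariant.commutesShift_wold (hS : ShiftInvariant N) :
    CommutesShift hS.wold.toContinuousLinearMap := by
  have h : hS.wold.toContinuousLinearMap ∘L (shift _).toContinuousLinearMap =
      (shift K).toContinuousLinearMap ∘L hS.wold.toContinuousLinearMap := by
    refine clm_ext fun n w => ?_
    change hS.wold (shift _ (monomial _ n w)) = shift K (hS.wold (monomial _ n w))
    rw [shift_monomial, hS.wold_monomial, hS.wold_monomial, Function.iterate_succ_apply']
  exact fun f => DFunLike.congr_fun h f

theorem ShiftInvariant.wold_coeff (hS : ShiftInvariant N) (u : HardySpace (wandering N)) (n : ℕ)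
    (hu : ∀ k, ∀ m ≠ 0, (u k : HardySpace K) m = 0) : hS.wold u n = (u n : HardySpace K) 0 := by
  have h := ContinuousLinearMap.hasSum (coeffCLM K n) (hS.hasSum_wold u)
  refine h.unique ?_
  convert hasSum_ite_eq n ((u n : HardySpace K) 0) using 2 with k
  rw [coeffCLM_apply, shift_iterate_coeff]
  rcases lt_trichotomy k n with hk | rfl | hk
  · rw [if_pos hk.le, if_neg hk.ne, hu _ _ (by omega)]
  · simp
  · rw [if_neg hk.not_ge, if_neg hk.ne']

/-- The range is closed, so it suffices that an element of `N` orthogonal to every `z ^ n W` is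
zero. Splitting `N` as `zN` plus `W` repeatedly shows that it lies in `z ^ n N` for every `n`, so
all its coefficients vanish: the shift has no unitary part. -/
theorem ShiftInvariant.range_wold (hS : ShiftInvariant N)
    (hN : IsClosed (N : Set (HardySpace K))) : Set.range hS.wold = N := by
  have hcN : CompleteSpace N := hN.completeSpace_coe
  have hcM : CompleteSpace (N.map (shift K).toLinearMap) := by
    have : IsClosed (N.map (shift K).toLinearMap : Set (HardySpace K)) := by
      rw [Submodule.map_coe]
      exact (shift K).isometry.isClosedEmbedding.isClosedMap _ hN
    exact this.completeSpace_coe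
  have hcW : CompleteSpace (wandering N) := (isClosed_wandering hN).completeSpace_coe
  have hsub : ∀ u, hS.wold u ∈ N := fun u =>
    hN.mem_of_tendsto (hS.hasSum_wold u) (Eventually.of_forall fun s =>
      N.sum_mem fun n _ => hS.iterate_mem n (u n).2.1)
  refine Set.Subset.antisymm (Set.range_subset_iff.2 hsub) fun g hg => ?_
  set R : Submodule ℂ (HardySpace K) := hS.wold.toLinearMap.range with hR
  have hRc : CompleteSpace R := by
    have : IsClosed (R : Set (HardySpace K)) := by
      rw [hR, LinearMap.coe_range]
      exact hS.wold.isometry.isClosedEmbedding.isClosed_range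
    exact this.completeSpace_coe
  obtain ⟨a, ⟨u, rfl⟩, b, hb, rfl⟩ := R.exists_add_mem_mem_orthogonal g
  have hbN : b ∈ N := (N.add_mem_iff_right (hsub u)).1 hg
  have hperp : ∀ n, ∀ w ∈ wandering N, inner ℂ ((shift K)^[n] w) b = 0 := fun n w hw => by
    rw [← hS.wold_monomial n ⟨w, hw⟩]
    exact hb _ ⟨_, rfl⟩
  have hdiv : ∀ n, ∃ c ∈ N, b = (shift K)^[n] c := by
    intro n
    induction n with
    | zero => exact ⟨b, hbN, rfl⟩
    | succ n ih =>
      obtain ⟨c, hc, hbc⟩ := ih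
      obtain ⟨_, ⟨d, hd, rfl⟩, w, hw, hcw⟩ :=
        (N.map (shift K).toLinearMap).exists_add_mem_mem_orthogonal c
      have hwN : w ∈ N := by
        have h1 : (shift K).toLinearMap d + w ∈ N := hcw ▸ hc
        exact (N.add_mem_iff_right (hS d hd)).1 h1
      have h0 := hperp n w ⟨hwN, hw⟩
      rw [hbc, inner_shift_iterate, hcw, inner_add_right,
        Submodule.inner_left_of_mem_orthogonal (Submodule.mem_map_of_mem hd) hw, zero_add,
        inner_self_eq_zero] at h0
      rw [h0, add_zero] at hcw
      refine ⟨d, hd, ?_⟩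
      rw [hbc, hcw, Function.iterate_succ_apply]
      rfl
  have hb0 : b = 0 := by
    ext n
    obtain ⟨c, -, hc⟩ := hdiv (n + 1)
    rw [hc, shift_iterate_coeff, if_neg (by omega)]
    rfl
  exact ⟨u, by rw [hb0, add_zero]; rfl⟩

/-! ### The dimension of the wandering subspace -/

omit [CompleteSpace K] in
theorem orthonormal_iterate_wandering (hS : ShiftInvariant N) {ι : Type*} {b : ι → wandering N}
    (hb : Orthonormal ℂ b) :
    Orthonormal ℂ fun p : ι × ℕ => (shift K)^[p.2] (b p.1 : HardySpace K) := by
  classical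
  rw [orthonormal_iff_ite]
  rintro ⟨i, n⟩ ⟨j, m⟩
  rcases lt_trichotomy n m with h | rfl | h
  · rw [inner_iterate_wandering hS (b i).2 (b j).2.1 h, if_neg (by simp [h.ne])]
  · have := orthonormal_iff_ite.1 hb i j
    rw [inner_shift_iterate]
    simpa using this
  · rw [← inner_conj_symm, inner_iterate_wandering hS (b j).2 (b i).2.1 h, if_neg (by simp [h.ne']),
      map_zero]

theorem _root_.HilbertBasis.tsum_ofReal_norm_inner_sq {ι X : Type*} [NormedAddCommGroup X]
    [InnerProductSpace ℂ X] (e : HilbertBasis ι ℂ X) (x : X) :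
    ∑' i, ENNReal.ofReal (‖(inner ℂ (e i) x : ℂ)‖ ^ 2) = ENNReal.ofReal (‖x‖ ^ 2) := by
  have h := lp.hasSum_norm (p := 2) (by norm_num) (e.repr x)
  norm_num at h
  simp only [e.repr_apply_apply] at h
  rw [← h.tsum_eq, ENNReal.ofReal_tsum_of_nonneg (fun i => sq_nonneg _) h.summable]

-- Bessel's inequality for the monomial `z ^ m y` against the orthonormal vectors `z ^ (m - n) b i`,
-- whose inner products with it have absolute values `|⟪y, b i n⟫|`. For a finite set of pairs `(i,
-- n)`, `m` is taken to be the largest `n`.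
omit [CompleteSpace K] in
theorem tsum_inner_wandering_le (hS : ShiftInvariant N) {ι : Type*} {b : ι → wandering N}
    (hb : Orthonormal ℂ b) {y : K} (hy : ‖y‖ = 1) :
    ∑' i, ∑' n, ENNReal.ofReal (‖(inner ℂ y ((b i : HardySpace K) n) : ℂ)‖ ^ 2) ≤ 1 := by
  classical
  rw [← ENNReal.tsum_prod (f := fun i n =>
    ENNReal.ofReal (‖(inner ℂ y ((b i : HardySpace K) n) : ℂ)‖ ^ 2)), ENNReal.tsum_eq_iSup_sum]
  refine iSup_le fun t => ?_
  rw [← ENNReal.ofReal_sum_of_nonneg fun p _ => sq_nonneg _]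
  refine ENNReal.ofReal_le_one.2 ?_
  set m := t.sup Prod.snd with hm
  have hle : ∀ p ∈ t, p.2 ≤ m := fun p hp => Finset.le_sup hp
  have hinj : Set.InjOn (fun p : ι × ℕ => (p.1, m - p.2)) t := by
    rintro ⟨i, n⟩ hp ⟨j, k⟩ hq h
    have h1 := hle _ hp
    have h2 := hle _ hq
    simp only [Prod.mk.injEq] at h h1 h2 ⊢
    exact ⟨h.1, by omega⟩
  have hbessel := (orthonormal_iterate_wandering hS hb).sum_inner_products_le (monomial K m y)
    (s := t.image fun p : ι × ℕ => (p.1, m - p.2))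
  rw [LinearIsometry.norm_map, hy, one_pow, Finset.sum_image hinj] at hbessel
  refine le_of_eq_of_le (Finset.sum_congr rfl fun p hp => ?_) hbessel
  rw [norm_inner_symm _ (monomial K m y), inner_monomial_left, shift_iterate_coeff, if_pos (Nat.sub_le _ _),
    Nat.sub_sub_self (hle p hp)]

/-- A nonnegative matrix with row sums `1` and column sums at most `1` has at most as many rows as
columns. -/
theorem _root_.nonempty_embedding_of_tsum.{u} {ι κ : Type u} (α : ι → κ → ENNReal)
    (hrow : ∀ i, ∑' k, α i k = 1) (hcol : ∀ k, ∑' i, α i k ≤ 1) : Nonempty (ι ↪ κ) := by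
  have hle : ∑' _ : ι, (1 : ENNReal) ≤ ∑' _ : κ, 1 := by
    calc ∑' _ : ι, (1 : ENNReal) = ∑' i, ∑' k, α i k := by simp_rw [hrow]
      _ = ∑' k, ∑' i, α i k := ENNReal.tsum_comm
      _ ≤ _ := ENNReal.tsum_le_tsum hcol
  -- With finitely many columns, comparing total sums compares cardinalities. With infinitely many,
  -- send each row to a column where it is nonzero; each column has countable support, so there are
  -- at most `#κ * ℵ₀ = #κ` rows.
  rcases finite_or_infinite κ with hκ | hκ
  · have := Fintype.ofFinite κ
    have hι : Finite ι := by
      by_contra h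
      rw [not_finite_iff_infinite] at h
      rw [ENNReal.tsum_const_eq_top_of_ne_zero one_ne_zero, top_le_iff, tsum_fintype] at hle
      simp at hle
    have := Fintype.ofFinite ι
    rw [tsum_fintype, tsum_fintype] at hle
    simp only [Finset.sum_const, Finset.card_univ, nsmul_eq_mul, mul_one, Nat.cast_le] at hle
    exact Function.Embedding.nonempty_of_card_le hle
  · have hex : ∀ i, ∃ k, α i k ≠ 0 := fun i => by
      by_contra! h
      simpa [h] using hrow i
    choose k hk using hex
    have hcount : ∀ c, {i | α i c ≠ 0}.Countable := fun c =>
      Summable.countable_support_ennreal ((hcol c).trans_lt ENNReal.one_lt_top).ne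
    have hf : ∀ c, ∃ f : ι → ℕ, Set.InjOn f {i | α i c ≠ 0} := fun c =>
      Set.countable_iff_exists_injOn.1 (hcount c)
    choose f hf using hf
    have hinj : Function.Injective fun i => (k i, f (k i) i) := fun i j h => by
      simp only [Prod.mk.injEq] at h
      refine hf (k i) (hk i) (h.1 ▸ hk j) ?_
      rw [h.2, h.1]
    have h1 : Cardinal.mk ι ≤ Cardinal.mk (κ × ULift.{u} ℕ) :=
      Cardinal.mk_le_of_injective (f := fun i => (k i, ULift.up (f (k i) i))) fun i j h =>
        hinj (by simpa using h)
    rw [← Cardinal.le_def]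
    refine h1.trans ?_
    rw [Cardinal.mk_prod, Cardinal.lift_id, Cardinal.lift_id]
    simp only [Cardinal.mk_uLift, Cardinal.mk_nat, Cardinal.lift_aleph0]
    exact (Cardinal.mul_aleph0_eq (Cardinal.aleph0_le_mk κ)).le

/-- The dimension of the wandering subspace is at most that of `K`. The matrix of squared
coefficients of a basis of `wandering N` along a basis of `K`, summed over degrees, has row sums `‖b
i‖ ^ 2 = 1` and column sums at most `1`. This is what allows the competitor built later to take
values in `K` itself. -/
theorem ShiftInvariant.exists_isometry (hS : ShiftInvariant N)
    (hN : IsClosed (N : Set (HardySpace K))) : Nonempty (wandering N →ₗᵢ[ℂ] K) := by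
  have hcW : CompleteSpace (wandering N) := (isClosed_wandering hN).completeSpace_coe
  obtain ⟨s, b, -⟩ := exists_hilbertBasis ℂ (wandering N)
  obtain ⟨t, e, -⟩ := exists_hilbertBasis ℂ K
  obtain ⟨ι⟩ := nonempty_embedding_of_tsum
    (fun (i : s) (k : t) => ∑' n, ENNReal.ofReal (‖(inner ℂ (e k) ((b i : HardySpace K) n) : ℂ)‖ ^ 2))
    (fun i => by
      rw [ENNReal.tsum_comm]
      simp_rw [e.tsum_ofReal_norm_inner_sq]
      rw [← ENNReal.ofReal_tsum_of_nonneg (fun n => sq_nonneg _) (summable_norm_sq _),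
        ← norm_sq_eq_tsum]
      have : ‖(b i : HardySpace K)‖ = 1 := b.orthonormal.1 i
      simp [this])
    (fun k => tsum_inner_wandering_le hS b.orthonormal (e.orthonormal.1 k))
  have h := (e.orthonormal.comp ι ι.injective).orthogonalFamily
  exact ⟨h.linearIsometry.comp b.repr.toLinearIsometry⟩

end Complete

/-! ### Coefficientwise application of an isometry -/

section Map

variable {W : Type*} [NormedAddCommGroup W] [InnerProductSpace ℂ W]

/-- The isometry of Hardy spaces induced by an isometry of coefficient spaces. -/
def mapIsometry (J : W →ₗᵢ[ℂ] K) : HardySpace W →ₗᵢ[ℂ] HardySpace K where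
  toFun f := mk (fun n => J (f n)) (by simpa using summable_norm_sq f)
  map_add' f g := by
    ext n
    simp
  map_smul' c f := by
    ext n
    simp
  norm_map' f := by
    refine (sq_eq_sq₀ (norm_nonneg _) (norm_nonneg _)).1 ?_
    rw [norm_sq_eq_tsum, norm_sq_eq_tsum]
    simp

@[simp] theorem mapIsometry_coeff (J : W →ₗᵢ[ℂ] K) (f : HardySpace W) (n : ℕ) :
    mapIsometry J f n = J (f n) := rfl

theorem mapIsometry_shift (J : W →ₗᵢ[ℂ] K) (f : HardySpace W) :
    mapIsometry J (shift W f) = shift K (mapIsometry J f) := by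
  ext n
  cases n <;> simp

theorem evalCLM_mapIsometry [CompleteSpace W] [CompleteSpace K] (J : W →ₗᵢ[ℂ] K) {z : ℂ}
    (hz : ‖z‖ < 1) (f : HardySpace W) : evalCLM K z (mapIsometry J f) = J (evalCLM W z f) := by
  refine (hasSum_evalCLM hz _).unique ?_
  have h := ContinuousLinearMap.hasSum J.toContinuousLinearMap (hasSum_evalCLM hz f)
  simpa using h

end Map

end HardySpace

open HardySpace

/-! ### Extremality characterises outer functions -/

section Extremal

variable {H : Type*} [NormedAddCommGroup H] [InnerProductSpace ℂ H] [CompleteSpace H]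
  {K : Type*} [NormedAddCommGroup K] [InnerProductSpace ℂ K] [CompleteSpace K]
  {L : Type*} [NormedAddCommGroup L] [InnerProductSpace ℂ L] [CompleteSpace L]
  {F : ℂ → H →L[ℂ] K}

/-- An element of the Hardy space which attains its norm at a point of the disk is constant. -/
theorem HardySpace.eq_monomial_of_norm_le {w : HardySpace K} {c : ℝ}
    (hw : ∀ z : ℂ, ‖z‖ < 1 → ‖evalCLM K z w‖ ≤ c) {z₀ : ℂ} (hz₀ : ‖z₀‖ < 1)
    (h : c ≤ ‖evalCLM K z₀ w‖) : w = monomial K 0 (evalCLM K z₀ w) := by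
  -- The real inner product makes `K` strictly convex, so the maximum principle gives a constant
  -- function and not only a constant norm.
  let _ : InnerProductSpace ℝ K := InnerProductSpace.rclikeToReal ℂ K
  have heq := Complex.eqOn_of_isPreconnected_of_isMaxOn_norm
    (f := fun z => evalCLM K z w) (convex_ball (0 : ℂ) 1).isPreconnected Metric.isOpen_ball
    (differentiableOn_evalCLM.clm_apply (differentiableOn_const w)) (mem_ball_zero_iff.2 hz₀)
    (fun z hz => (hw z (mem_ball_zero_iff.1 hz)).trans h)
  refine evalCLM_injective fun z hz => ?_
  rw [evalCLM_monomial hz, pow_zero, one_smul]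
  exact heq (mem_ball_zero_iff.2 hz)

/-- When `wandering N` consists of constants, the Wold series of an element of `N` is its own power
series, so `N` is the Hardy space of its constants. -/
theorem HardySpace.ShiftInvariant.eq_of_wandering_const {N : Submodule ℂ (HardySpace K)}
    (hS : ShiftInvariant N) (hN : IsClosed (N : Set (HardySpace K)))
    (hW : ∀ w ∈ wandering N, ∃ v, w = monomial K 0 v) :
    (N : Set (HardySpace K)) = {g | ∀ n, g n ∈ N.comap (monomial K 0).toLinearMap} := by
  refine Set.Subset.antisymm (fun g hg n => ?_) fun g hg => ?_
  · rw [← hS.range_wold hN] at hg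
    obtain ⟨u, rfl⟩ := hg
    have hu : ∀ k, ∀ m ≠ 0, (u k : HardySpace K) m = 0 := fun k m hm => by
      obtain ⟨v, hv⟩ := hW _ (u k).2
      rw [hv, monomial_coeff, if_neg hm]
    rw [hS.wold_coeff u n hu]
    obtain ⟨v, hv⟩ := hW _ (u n).2
    have hn := (u n).2.1
    rw [hv] at hn ⊢
    rw [monomial_coeff_self]
    exact hn
  · refine hN.mem_of_tendsto (hasSum_monomial g) (Eventually.of_forall fun s =>
      N.sum_mem fun n _ => ?_)
    have h := hS.iterate_mem n (hg n)
    change (shift K)^[n] (monomial K 0 (g n)) ∈ N at h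
    rwa [shift_iterate_monomial] at h

omit [CompleteSpace H] [CompleteSpace K] in
theorem shiftInvariant_topologicalClosure_range {T : HardySpace H →L[ℂ] HardySpace K}
    (hT : CommutesShift T) : ShiftInvariant T.range.topologicalClosure := by
  intro g hg
  refine map_mem_closure (shift K).continuous hg ?_
  rintro _ ⟨f, rfl⟩
  exact ⟨shift H f, hT f⟩

/-- A function dominating all its competitors at one point of the disk is outer. -/
theorem IsHInfty.isOuter_of_forall_gram_le (hF : IsHInfty F) {z₀ : ℂ} (hz₀ : ‖z₀‖ < 1)
    (h : ∀ G : ℂ → H →L[ℂ] K, IsCompetitor F G → gram (G z₀) ≤ gram (F z₀)) : IsOuter F := by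
  set A := hF.mult with hA
  have hAS : CommutesShift A := hF.commutesShift_mult
  set N := A.range.topologicalClosure with hNdef
  have hN : IsClosed (N : Set (HardySpace K)) := Submodule.isClosed_topologicalClosure _
  have hS : ShiftInvariant N := shiftInvariant_topologicalClosure_range hAS
  have hcW : CompleteSpace (wandering N) := (isClosed_wandering hN).completeSpace_coe
  obtain ⟨J⟩ := hS.exists_isometry hN
  set Θ := hS.wold with hΘ
  have hΘS : CommutesShift Θ.toContinuousLinearMap := hS.commutesShift_wold
  -- Since `Θ` is an isometry onto `N`, which contains the range of `A`, this is the outer factor in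
  -- `A = Θ C`.
  set C := Θ.toContinuousLinearMap.adjoint ∘L A with hC
  have hΘC : ∀ f, Θ (C f) = A f := fun f => by
    have : A f ∈ Set.range Θ := by
      rw [hS.range_wold hN]
      exact subset_closure ⟨f, rfl⟩
    obtain ⟨u, hu⟩ := this
    have hadj : C f = u := by
      refine ext_inner_left ℂ fun v => ?_
      rw [hC, ContinuousLinearMap.comp_apply, ContinuousLinearMap.adjoint_inner_right, ← hu]
      exact Θ.inner_map_map v u
    rw [hadj, hu]
  have hCS : CommutesShift C := fun f => Θ.injective <| by
    rw [hΘC, hAS]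
    have := hΘS (C f)
    change Θ (shift _ (C f)) = shift K (Θ (C f)) at this
    rw [this, hΘC]
  -- Discarding the inner factor `Θ` preserves the Gram form; `J` moves the values from the
  -- wandering subspace into `K`, so the symbol of `T` is an admissible competitor.
  set T := (mapIsometry J).toContinuousLinearMap ∘L C with hT
  have hTS : CommutesShift T := fun f => by
    change mapIsometry J (C (shift H f)) = shift K (mapIsometry J (C f))
    rw [hCS, mapIsometry_shift]
  have hcomp : IsCompetitor F (symbol T) := by
    refine ⟨isHInfty_symbol hTS,
      hF.sameModulus_of_inner_mult_eq (isHInfty_symbol hTS) fun f g => ?_⟩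
    rw [IsHInfty.mult_symbol hTS, ← hA, ← hΘC f, ← hΘC g, Θ.inner_map_map]
    exact (mapIsometry J).inner_map_map _ _
  have hle : ∀ f, ‖evalCLM _ z₀ (C f)‖ ≤ ‖evalCLM K z₀ (Θ (C f))‖ := fun f => by
    have h1 := (gram_le_gram_iff _ _).1 (h _ hcomp) (evalCLM H z₀ f)
    rw [← evalCLM_map hTS hz₀, ← hF.evalCLM_mult hz₀, ← hA, ← hΘC] at h1
    change ‖evalCLM K z₀ (mapIsometry J (C f))‖ ≤ _ at h1
    rwa [evalCLM_mapIsometry J hz₀, J.norm_map] at h1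
  have hdense : DenseRange C := fun u => by
    have hu : Θ u ∈ closure (Set.range A) := by
      have : Θ u ∈ (N : Set (HardySpace K)) := hS.range_wold hN ▸ ⟨u, rfl⟩
      exact this
    rw [Metric.mem_closure_range_iff] at hu ⊢
    intro ε hε
    obtain ⟨f, hf⟩ := hu ε hε
    refine ⟨f, ?_⟩
    rwa [← Θ.isometry.dist_eq, hΘC]
  have hle' : ∀ u, ‖evalCLM _ z₀ u‖ ≤ ‖evalCLM K z₀ (Θ u)‖ := fun u => by
    refine hdense.induction_on u (isClosed_le ?_ ?_) hle
    · exact (evalCLM _ z₀).continuous.norm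
    · exact ((evalCLM K z₀).continuous.comp Θ.continuous).norm
  have hW : ∀ w ∈ wandering N, ∃ v, w = monomial K 0 v := fun w hw => by
    have hmon : Θ (monomial _ 0 ⟨w, hw⟩) = w := hS.wold_monomial 0 ⟨w, hw⟩
    have heval : ∀ z : ℂ, ‖z‖ < 1 → evalCLM (wandering N) z (monomial _ 0 ⟨w, hw⟩) = ⟨w, hw⟩ :=
      fun z hz => by rw [evalCLM_monomial hz, pow_zero, one_smul]
    -- As `Θ` maps the constant function with value `w` to `w` itself, contractivity bounds all
    -- values of `w` by `‖w‖`, and the extremal inequality shows that this bound is attained at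
    -- `z₀`.
    refine ⟨_, eq_monomial_of_norm_le (c := ‖w‖) (fun z hz => ?_) hz₀ ?_⟩
    · have h1 := norm_evalCLM_map_le hΘS hz (monomial _ 0 ⟨w, hw⟩)
      change ‖evalCLM K z (Θ (monomial _ 0 ⟨w, hw⟩))‖ ≤ _ at h1
      rw [hmon, heval z hz] at h1
      exact h1.trans (mul_le_of_le_one_left (norm_nonneg _) Θ.norm_toContinuousLinearMap_le)
    · have h1 := hle' (monomial _ 0 ⟨w, hw⟩)
      rwa [heval z₀ hz₀, hmon] at h1
  refine hF.isOuter_iff.2 ⟨N.comap (monomial K 0).toLinearMap, ?_, ?_⟩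
  · exact hN.preimage (monomial K 0).continuous
  · rw [← hS.eq_of_wandering_const hN hW, hNdef, Submodule.topologicalClosure_coe,
      LinearMap.coe_range]
    rfl

/-- An outer function dominates its competitors. -/
theorem IsHInfty.gram_le_of_isOuter (hF : IsHInfty F) (hO : IsOuter F) {G : ℂ → H →L[ℂ] L}
    (hG : IsCompetitor F G) :
    (∀ z ∈ Metric.ball (0 : ℂ) 1, gram (G z) ≤ gram (F z)) ∧
      (∀ k : ℕ, ∑ i ∈ Finset.range (k + 1), gram (taylorCoeff G i) ≤
        ∑ i ∈ Finset.range (k + 1), gram (taylorCoeff F i)) ∧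
      ∀ k : ℕ, gram (toeplitzBlock G k) ≤ gram (toeplitzBlock F k) := by
  obtain ⟨hG1, hG2⟩ := hG
  obtain ⟨M, -, hM⟩ := hF.isOuter_iff.1 hO
  have hnorm : ∀ f, ‖hG1.mult f‖ ≤ ‖hF.mult f‖ := fun f => by
    have h := hF.inner_mult_eq hG1 hG2 f f
    rw [inner_self_eq_norm_sq_to_K, inner_self_eq_norm_sq_to_K] at h
    have h' : ‖hG1.mult f‖ ^ 2 = ‖hF.mult f‖ ^ 2 := by exact_mod_cast h
    exact ((sq_eq_sq₀ (norm_nonneg _) (norm_nonneg _)).1 h').le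
  obtain ⟨V, hV1, hV, hVF⟩ := exists_commutesShift_contraction hF.commutesShift_mult
    hG1.commutesShift_mult hnorm hM
  exact gram_le_of_contraction hF hG1 hV1 hV hVF

/-- The Toeplitz block applied to a vector supported in the last coordinate. -/
theorem IsHInfty.norm_toeplitzBlock_single_last (hF : IsHInfty F) (k : ℕ) (x : H) :
    ‖toeplitzBlock F k (PiLp.single 2 (Fin.last k) x)‖ = ‖F 0 x‖ := by
  have hsum : (∑ j : Fin (k + 1), monomial H j (PiLp.single 2 (β := fun _ => H) (Fin.last k) x j)) =
      (shift H)^[k] (monomial H 0 x) := by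
    rw [Finset.sum_eq_single (Fin.last k)]
    · rw [shift_iterate_monomial]
      simp
    · intro j _ hj
      simp [hj]
    · simp
  refine (sq_eq_sq₀ (norm_nonneg _) (norm_nonneg _)).1 ?_
  rw [hF.norm_toeplitzBlock_sq, hsum, hF.commutesShift_mult.iterate, Finset.sum_range_succ,
    Finset.sum_eq_zero, zero_add, shift_iterate_coeff, if_pos le_rfl, Nat.sub_self,
    ← hF.taylorCoeff_apply, IsHInfty.taylorCoeff_zero]
  intro i hi
  rw [shift_iterate_coeff, if_neg (by simpa using hi)]
  simp

end Extremal

end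

/-! ### The equivalences -/

theorem mainTheorem6 {H : Type*} [NormedAddCommGroup H] [InnerProductSpace ℂ H] [CompleteSpace H]
    {K : Type*} [NormedAddCommGroup K] [InnerProductSpace ℂ K] [CompleteSpace K]
    (F : ℂ → H →L[ℂ] K) (hF : IsHInfty F) :
    List.TFAE [
      IsOuter F,
      ∀ z ∈ Metric.ball (0 : ℂ) 1, ∀ G : ℂ → H →L[ℂ] K, IsCompetitor F G →
        gram (G z) ≤ gram (F z),
      ∃ z₀ ∈ Metric.ball (0 : ℂ) 1, ∀ G : ℂ → H →L[ℂ] K, IsCompetitor F G →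
        gram (G z₀) ≤ gram (F z₀),
      ∀ G : ℂ → H →L[ℂ] K, IsCompetitor F G →
        gram (taylorCoeff G 0) ≤ gram (taylorCoeff F 0),
      ∃ k : ℕ, ∀ G : ℂ → H →L[ℂ] K, IsCompetitor F G → ∀ l ≤ k,
        ∑ i ∈ Finset.range (l + 1), gram (taylorCoeff G i) ≤
          ∑ i ∈ Finset.range (l + 1), gram (taylorCoeff F i),
      ∀ k : ℕ, ∀ G : ℂ → H →L[ℂ] K, IsCompetitor F G →
        ∑ i ∈ Finset.range (k + 1), gram (taylorCoeff G i) ≤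
          ∑ i ∈ Finset.range (k + 1), gram (taylorCoeff F i),
      ∃ k : ℕ, ∀ G : ℂ → H →L[ℂ] K, IsCompetitor F G →
        gram (toeplitzBlock G k) ≤ gram (toeplitzBlock F k),
      ∀ k : ℕ, ∀ G : ℂ → H →L[ℂ] K, IsCompetitor F G →
        gram (toeplitzBlock G k) ≤ gram (toeplitzBlock F k)] ∧
    -- if `F` is outer, the competitors may even take values in another Hilbert space
    (IsOuter F → ∀ (L : Type*) [NormedAddCommGroup L] [InnerProductSpace ℂ L] [CompleteSpace L]
      (G : ℂ → H →L[ℂ] L), IsCompetitor F G →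
        (∀ z ∈ Metric.ball (0 : ℂ) 1, gram (G z) ≤ gram (F z)) ∧
        gram (taylorCoeff G 0) ≤ gram (taylorCoeff F 0) ∧
        (∀ k : ℕ, ∑ i ∈ Finset.range (k + 1), gram (taylorCoeff G i) ≤
          ∑ i ∈ Finset.range (k + 1), gram (taylorCoeff F i)) ∧
        (∀ k : ℕ, gram (toeplitzBlock G k) ≤ gram (toeplitzBlock F k))) := by
  have h0 : (0 : ℂ) ∈ Metric.ball (0 : ℂ) 1 := Metric.mem_ball_self one_pos
  refine ⟨?_, fun hO L _ _ _ G hG => ?_⟩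
  · tfae_have 1 → 2 := fun hO z hz G hG => (hF.gram_le_of_isOuter hO hG).1 z hz
    tfae_have 1 → 6 := fun hO k G hG => (hF.gram_le_of_isOuter hO hG).2.1 k
    tfae_have 1 → 8 := fun hO k G hG => (hF.gram_le_of_isOuter hO hG).2.2 k
    tfae_have 2 → 3 := fun h => ⟨0, h0, h 0 h0⟩
    tfae_have 8 → 7 := fun h => ⟨0, h 0⟩
    tfae_have 6 → 5 := fun h => ⟨0, fun G hG l _ => h l G hG⟩
    tfae_have 5 → 4 := fun ⟨k, h⟩ G hG => by simpa using h G hG 0 (Nat.zero_le k)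
    -- On a vector supported in the last coordinate a Toeplitz block acts through its zeroth Taylor
    -- coefficient alone, which recovers the inequality at the origin.
    tfae_have 7 → 4 := fun ⟨k, h⟩ G hG => by
      rw [IsHInfty.taylorCoeff_zero, IsHInfty.taylorCoeff_zero, gram_le_gram_iff]
      intro x
      rw [← hF.norm_toeplitzBlock_single_last k, ← hG.1.norm_toeplitzBlock_single_last k]
      exact (gram_le_gram_iff _ _).1 (h G hG) _
    tfae_have 4 → 3 := fun h => ⟨0, h0, fun G hG => by
      simpa only [IsHInfty.taylorCoeff_zero] using h G hG⟩
    tfae_have 3 → 1 := fun ⟨z₀, hz₀, h⟩ =>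
      hF.isOuter_of_forall_gram_le (mem_ball_zero_iff.1 hz₀) h
    tfae_finish
  · obtain ⟨h1, h2, h3⟩ := hF.gram_le_of_isOuter hO hG
    refine ⟨h1, ?_, h2, h3⟩
    rw [IsHInfty.taylorCoeff_zero, IsHInfty.taylorCoeff_zero]
    exact h1 0 h0
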